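/- Let $p\in(1,\infty)$, $r>0$, let $m\ge 2$ be an integer, and put $p^*=p/(p-1)$. For a real potential $q\in L^p(0,1)$ consider the Dirichlet problem $-\psi''+q\psi=\lambda\psi$ on $[0,1]$, $\psi(0)=\psi(1)=0$, where a solution is a $C^1$ function with absolutely continuous derivative that satisfies the equation almost everywhere; $\lambda\in\mathbb R$ is an eigenvalue if there is a solution $\psi\not\equiv0$. For every such $q$ the eigenvalues form a strictly increasing sequence $\lambda_1(q)<\lambda_2(q)<\cdots$ tending to $+\infty$. Let $\mathscr E_m(q)=\sum_{i=1}^m\lambda_i(q)$ and $B_{p,r}=\{q\in L^p(0,1):\|q\|_p\le r\}$. Then the minimum $\mathscr E_m^-=\min_{q\in B_{p,r}}\mathscr E_m(q)$ and the maximum $\mathscr E_m^+=\max_{q\in B_{p,r}}\mathscr E_m(q)$ are attained. Moreover, let $q^-\in B_{p,r}$ be any minimizer (and set $\varepsilon=-1$), respectively let $q^+\in B_{p,r}$ be any maximizer (and set $\varepsilon=+1$). Then, for the corresponding $\varepsilon$, there are real numbers $\mu_1,\dots,\mu_m$ and twice differentiable functions $u_1,\dots,u_m:[0,1]\to\mathbb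 R$, none of them identically zero, such that \[ -u_i''+\varepsilon\Bigl(\sum_{j=1}^m u_j^2\Bigr)^{p^*-1}u_i=\mu_i u_i\quad\text{on }[0,1],\qquad i=1,\dots,m, \] and (i) $u_i(0)=u_i(1)=0$ for $i=1,\dots,m$; (ii) $\displaystyle\int_0^1\Bigl(\sum_{i=1}^m u_i(x)^2\Bigr)^{p^*}\,dx=r^p$, and the optimizing potential is $\displaystyle q^{\varepsilon}(x)=\varepsilon\Bigl(\sum_{i=1}^m u_i(x)^2\Bigr)^{p^*-1}$ for almost every $x\in[0,1]$; (iii) the extremal value is $\mathscr E_m^{\varepsilon}=\sum_{i=1}^m\mu_i$. -/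

import Mathlib

open MeasureTheory Set Filter Topology

noncomputable section

/-- Lebesgue measure on the unit interval `Ω = [0, 1]`. -/
abbrev unitMeasure : Measure ℝ := volume.restrict (Icc (0 : ℝ) 1)

/-- The real Lebesgue space `L^p(Ω)`, for a real exponent `p`. -/
abbrev LpSpace (p : ℝ) : Type := Lp ℝ (ENNReal.ofReal p) unitMeasure

/-- The ball `B_{p,r}` of radius `r` centred at the origin of `L^p(Ω)`. -/
def lpBall (p r : ℝ) : Set (LpSpace p) := {q | ‖q‖ ≤ r}

/-- `ψ` solves `-ψ'' + q ψ = lam ψ` on `[0, 1]` with `ψ 0 = ψ 1 = 0`, in the Carathéodory sense: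
`ψ` is differentiable on `[0, 1]`, its derivative `w` is absolutely continuous,
and the equation holds almost everywhere. -/
def IsDirichletSolution (q : ℝ → ℝ) (lam : ℝ) (ψ : ℝ → ℝ) : Prop :=
  (∃ w : ℝ → ℝ,
    (∀ x ∈ Icc (0 : ℝ) 1, HasDerivWithinAt ψ (w x) (Icc 0 1) x) ∧
    AbsolutelyContinuousOnInterval w 0 1 ∧
    ∀ᵐ x ∂unitMeasure, ∃ w' : ℝ, HasDerivAt w w' x ∧ -w' + q x * ψ x = lam * ψ x) ∧
  ψ 0 = 0 ∧ ψ 1 = 0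

/-- `lam` is a Dirichlet eigenvalue of `-ψ'' + q ψ` on `[0, 1]`. -/
def IsDirichletEigenvalue (q : ℝ → ℝ) (lam : ℝ) : Prop :=
  ∃ ψ : ℝ → ℝ, IsDirichletSolution q lam ψ ∧ ∃ x ∈ Icc (0 : ℝ) 1, ψ x ≠ 0

/-- The Dirichlet eigenvalues of `-ψ'' + q ψ` in increasing order, counted from `0`:
`dirichletEigenvalue q n` is the eigenvalue that has exactly `n` eigenvalues below it. -/
def dirichletEigenvalue (q : ℝ → ℝ) (n : ℕ) : ℝ :=
  sInf {lam | IsDirichletEigenvalue q lam ∧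
    {ν | IsDirichletEigenvalue q ν ∧ ν < lam}.encard = n}

/-- The sum of the first `m` Dirichlet eigenvalues. -/
def eigenvalueSum (m : ℕ) (q : ℝ → ℝ) : ℝ := ∑ i ∈ Finset.range m, dirichletEigenvalue q i

/-- The same sum as a functional on `L^p(Ω)`. -/
def eigenvalueSumLp (p : ℝ) (m : ℕ) (q : LpSpace p) : ℝ := eigenvalueSum m q

/-- The conjugate exponent `p* = p / (p - 1)`. -/
def conjExponent (p : ℝ) : ℝ := p / (p - 1)

/-- The function `ε (∑ⱼ uⱼ²)^{p* - 1}`. -/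
def criticalPotential (p ε : ℝ) {m : ℕ} (u : Fin m → ℝ → ℝ) (x : ℝ) : ℝ :=
  ε * (∑ j, u j x ^ 2) ^ (conjExponent p - 1)

/-- `u` is a classical solution on `[0, 1]`, all of whose components are non-trivial, of the system
`-uᵢ'' + ε (∑ⱼ uⱼ²)^{p* - 1} uᵢ = μᵢ uᵢ` with Dirichlet boundary conditions. -/
structure IsCriticalSolution (p ε : ℝ) {m : ℕ} (μ : Fin m → ℝ) (u : Fin m → ℝ → ℝ) : Prop where
  equation : ∃ v w : Fin m → ℝ → ℝ, ∀ i, ∀ x ∈ Icc (0 : ℝ) 1,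
    HasDerivWithinAt (u i) (v i x) (Icc 0 1) x ∧
    HasDerivWithinAt (v i) (w i x) (Icc 0 1) x ∧
    -w i x + criticalPotential p ε u x * u i x = μ i * u i x
  boundary : ∀ i, u i 0 = 0 ∧ u i 1 = 0
  nontrivial : ∀ i, ∃ x ∈ Icc (0 : ℝ) 1, u i x ≠ 0

end

noncomputable section

/-! Everything rests on one inequality. By Ky Fan's principle (`eigenvalueSum_le_sum_energyForm`)
the sum E(q) of the first m eigenvalues is at most the total energy of any m orthonormal trial
functions, with equality for the eigenfunctions. The energies are affine in q, so E is concave.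
Trying the eigenfunctions of q₀ in the problem for q gives E(q) ≤ E(q₀) + ∫ (q - q₀) ρ, where ρ is
the sum of the squares of the first m normalized eigenfunctions of q₀ (`eigenvalueSum_le_add`). The
linear functional q ↦ ∫ q ρ has a unique maximizer over the ball, a positive multiple of ρ^(p* - 1),
by the equality case of Hölder's inequality (`integral_dual_le`).

Minimum. Along a minimizing sequence the densities converge uniformly; the negative of the dual
potential of the limit density is a minimizer, so no limit of the potentials themselves is needed.
If q is any minimizer, comparing E at q with E at the negative dual potential of its own density
forces equality in Hölder's inequality.

Maximum. The ball is weakly sequentially compact in the ultrafilter sense, and the inequality at the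
weak limit shows that E is upper semicontinuous there. The first-order condition at a maximizer q
requires moving from q towards the dual potential and letting the step tend to zero, hence
continuity of the density in q (`tendstoUniformlyOn_density_of_tendsto`). That continuity uses
simplicity of the eigenvalues.

In both cases q = ε c ρ^(p* - 1) almost everywhere. Multiplying the eigenfunctions by c^((p - 1)/2)
absorbs c and gives the critical system, with the eigenvalues as μᵢ. Continuity of the right-hand
side upgrades Carathéodory solutions to classical ones.

The spectral theory is built from quadratic forms on L²(0, 1): a function in H¹ vanishing at 0 is
represented by its derivative w and recovered as `primitive w`. Potentials enter only through their
L¹ norm, thanks to the Sobolev inequality `sq_primitive_le`. Limits along ultrafilters replace the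
extraction of subsequences. -/

instance unitMeasure_isProbabilityMeasure : IsProbabilityMeasure unitMeasure :=
  ⟨by simp⟩

/-! ### Primitives and integration by parts -/

/-- The primitive `x ↦ ∫₀ˣ f` of a function on the unit interval. -/
def primitive (f : ℝ → ℝ) (x : ℝ) : ℝ := ∫ t in Iic x, f t ∂unitMeasure

lemma primitive_eq_intervalIntegral (f : ℝ → ℝ) (x : ℝ) :
    primitive f x = ∫ t in (0 : ℝ)..x, (Icc (0 : ℝ) 1).indicator f t := by
  rw [primitive, Measure.restrict_restrict measurableSet_Iic, inter_comm]
  rcases le_total 0 x with h | h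
  · rw [intervalIntegral.integral_of_le h, setIntegral_indicator measurableSet_Icc]
    apply setIntegral_congr_set
    have : (Ioc 0 x ∩ Icc (0 : ℝ) 1 : Set ℝ) =ᵐ[volume] (Icc 0 x ∩ Icc (0 : ℝ) 1 : Set ℝ) :=
      Ioc_ae_eq_Icc.inter (ae_eq_refl _)
    refine EventuallyEq.trans ?_ this.symm
    have h2 : Icc (0 : ℝ) 1 ∩ Iic x = Icc 0 x ∩ Icc (0 : ℝ) 1 := by
      ext t; simp only [mem_inter_iff, mem_Icc, mem_Iic]; grind
    rw [h2]
    exact ae_eq_refl _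
  · rw [intervalIntegral.integral_of_ge h, setIntegral_indicator measurableSet_Icc]
    have h1 : volume (Icc (0 : ℝ) 1 ∩ Iic x) = 0 :=
      measure_mono_null (t := {0}) (fun t ht => by simp at *; linarith) (by simp)
    have h2 : volume (Ioc x 0 ∩ Icc (0 : ℝ) 1) = 0 :=
      measure_mono_null (t := {0}) (fun t ht => by simp at *; linarith) (by simp)
    rw [setIntegral_measure_zero _ h1, setIntegral_measure_zero _ h2, neg_zero]

@[simp] lemma primitive_at_zero (f : ℝ → ℝ) : primitive f 0 = 0 := by
  simp [primitive_eq_intervalIntegral]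

lemma primitive_at_one (f : ℝ → ℝ) : primitive f 1 = ∫ t, f t ∂unitMeasure := by
  rw [primitive, Measure.restrict_restrict measurableSet_Iic]
  congr 2
  ext t; grind

lemma primitive_congr {f g : ℝ → ℝ} (h : f =ᵐ[unitMeasure] g) : primitive f = primitive g := by
  ext x
  exact integral_congr_ae (ae_restrict_of_ae h)

lemma primitive_add {f g : ℝ → ℝ} (hf : Integrable f unitMeasure) (hg : Integrable g unitMeasure) :
    primitive (f + g) = primitive f + primitive g := by
  ext x
  exact integral_add hf.restrict hg.restrict

lemma primitive_smul (c : ℝ) (f : ℝ → ℝ) : primitive (c • f) = c • primitive f := by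
  ext x
  exact integral_const_mul _ _

lemma primitive_sub_primitive {f : ℝ → ℝ} (hf : Integrable f unitMeasure) {x y : ℝ} (h : x ≤ y) :
    primitive f y - primitive f x = ∫ t in Ioc x y, f t ∂unitMeasure := by
  rw [primitive, primitive, intervalIntegral.integral_Iic_sub_Iic hf.integrableOn hf.integrableOn,
    intervalIntegral.integral_of_le h]

lemma integrable_indicator_unit {f : ℝ → ℝ} (hf : Integrable f unitMeasure) :
    Integrable ((Icc (0 : ℝ) 1).indicator f) :=
  (integrable_indicator_iff measurableSet_Icc).2 hf

lemma absolutelyContinuous_primitive {f : ℝ → ℝ} (hf : Integrable f unitMeasure) :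
    AbsolutelyContinuousOnInterval (primitive f) 0 1 := by
  have := ((integrable_indicator_unit hf).intervalIntegrable
    (a := 0) (b := 1)).absolutelyContinuousOnInterval_intervalIntegral (c := 0) (by simp)
  simpa only [← primitive_eq_intervalIntegral] using this

lemma continuous_primitive {f : ℝ → ℝ} (hf : Integrable f unitMeasure) :
    Continuous (primitive f) := by
  have : primitive f = fun x => ∫ t in (0 : ℝ)..x, (Icc (0 : ℝ) 1).indicator f t := by
    ext x; exact primitive_eq_intervalIntegral f x
  rw [this]
  exact intervalIntegral.continuous_primitive
    (fun a b => (integrable_indicator_unit hf).intervalIntegrable) 0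

lemma ae_hasDerivAt_primitive {f : ℝ → ℝ} (hf : Integrable f unitMeasure) :
    ∀ᵐ x ∂unitMeasure, HasDerivAt (primitive f) (f x) x := by
  have h := LocallyIntegrable.ae_hasDerivAt_integral
    (integrable_indicator_unit hf).locallyIntegrable
  have h2 := ae_restrict_of_ae (s := Icc (0 : ℝ) 1) h
  filter_upwards [h2, ae_restrict_mem measurableSet_Icc] with x hx hm
  have h3 := hx 0
  simpa only [← primitive_eq_intervalIntegral, indicator_of_mem hm] using h3

lemma integral_unitMeasure_eq (f : ℝ → ℝ) : ∫ x, f x ∂unitMeasure = ∫ x in (0 : ℝ)..1, f x := by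
  rw [intervalIntegral.integral_of_le zero_le_one, integral_Icc_eq_integral_Ioc]

/-- A function that is absolutely continuous on `[0, 1]` is the primitive of its derivative. -/
lemma primitive_eq_of_absolutelyContinuous {f f' : ℝ → ℝ}
    (hf : AbsolutelyContinuousOnInterval f 0 1)
    (hf' : ∀ᵐ x ∂unitMeasure, HasDerivAt f (f' x) x) :
    Integrable f' unitMeasure ∧ ∀ x ∈ Icc (0 : ℝ) 1, f x = f 0 + primitive f' x := by
  have hint := hf.intervalIntegrable_deriv
  have hae : deriv f =ᵐ[unitMeasure] f' := by
    filter_upwards [hf'] with x hx using hx.deriv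
  have hI : Integrable f' unitMeasure := by
    refine Integrable.congr ?_ hae
    exact (intervalIntegrable_iff_integrableOn_Icc_of_le zero_le_one).1 hint
  refine ⟨hI, fun x hx => ?_⟩
  have hmono : AbsolutelyContinuousOnInterval f 0 x := hf.mono (by
    rw [uIcc_of_le hx.1, uIcc_of_le zero_le_one]; exact Icc_subset_Icc_right hx.2)
  have h1 := hmono.integral_deriv_eq_sub
  have h2 : primitive f' x = ∫ t in (0 : ℝ)..x, deriv f t := by
    rw [← primitive_congr hae, primitive_eq_intervalIntegral]
    apply intervalIntegral.integral_congr
    intro t ht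
    rw [uIcc_of_le hx.1] at ht
    exact indicator_of_mem (s := Icc (0 : ℝ) 1) ⟨ht.1, ht.2.trans hx.2⟩ _
  rw [h2, h1]; ring

/-- A product of absolutely continuous functions is absolutely continuous, so it is the primitive of
the derivative given by the product rule. -/
lemma integral_mul_primitive_add {f g : ℝ → ℝ} (hf : Integrable f unitMeasure)
    (hg : Integrable g unitMeasure) {x : ℝ} (hx : x ∈ Icc (0 : ℝ) 1) :
    primitive (fun t => f t * primitive g t + primitive f t * g t) x
      = primitive f x * primitive g x := by
  have h := (absolutelyContinuous_primitive hf).mul (absolutelyContinuous_primitive hg)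
  have h2 := primitive_eq_of_absolutelyContinuous
    (f' := fun t => f t * primitive g t + primitive f t * g t) h ?_
  · have := h2.2 x hx
    simp at this
    exact this.symm
  · filter_upwards [ae_hasDerivAt_primitive hf, ae_hasDerivAt_primitive hg] with t h1 h2
    exact h1.mul h2

lemma integrable_mul_continuous {f g : ℝ → ℝ} (hf : Integrable f unitMeasure)
    (hg : Continuous g) : Integrable (fun x => f x * g x) unitMeasure :=
  IntegrableOn.mul_continuousOn hf hg.continuousOn isCompact_Icc

lemma integrable_unit_of_continuous {g : ℝ → ℝ}
    (hg : Continuous g) : Integrable g unitMeasure :=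
  hg.continuousOn.integrableOn_compact isCompact_Icc

/-- Integration by parts. -/
lemma integral_mul_primitive {f g : ℝ → ℝ} (hf : Integrable f unitMeasure)
    (hg : Integrable g unitMeasure) :
    ∫ x, f x * primitive g x ∂unitMeasure
      = primitive f 1 * primitive g 1 - ∫ x, primitive f x * g x ∂unitMeasure := by
  have h := integral_mul_primitive_add hf hg (x := 1) (by simp)
  rw [primitive_at_one, integral_add (integrable_mul_continuous hf (continuous_primitive hg))] at h
  · linarith
  · simpa only [mul_comm] using integrable_mul_continuous hg (continuous_primitive hf)

/-! ### Derivatives in L² and Sobolev estimates -/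

/-- The Hilbert space `L²(0, 1)`, in which derivatives of trial functions live. -/
abbrev L2Unit : Type := Lp ℝ 2 unitMeasure

lemma L2Unit.integrable (w : L2Unit) : Integrable w unitMeasure :=
  (Lp.memLp w).integrable one_le_two

lemma L2Unit.inner_eq (w z : L2Unit) : inner ℝ w z = ∫ x, w x * z x ∂unitMeasure := by
  rw [L2.inner_def]
  simp [mul_comm]

lemma L2Unit.integrable_mul (w z : L2Unit) : Integrable (fun x => w x * z x) unitMeasure := by
  have := L2.integrable_inner (𝕜 := ℝ) z w
  simpa using this

lemma primitive_coe_add (w z : L2Unit) : primitive ↑(w + z) = primitive w + primitive z := by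
  rw [primitive_congr (Lp.coeFn_add w z), primitive_add w.integrable z.integrable]

lemma primitive_coe_smul (c : ℝ) (w : L2Unit) : primitive ↑(c • w) = c • primitive w := by
  rw [primitive_congr (Lp.coeFn_smul c w), primitive_smul]

/-- The primitive of `w` at `x` as a linear functional of `w`. -/
def primitiveAt (x : ℝ) : L2Unit →ₗ[ℝ] ℝ where
  toFun w := primitive w x
  map_add' w z := by rw [primitive_coe_add]; rfl
  map_smul' c w := by rw [primitive_coe_smul]; rfl

lemma primitive_coe_sub (w z : L2Unit) (x : ℝ) :
    primitive ↑(w - z) x = primitive w x - primitive z x := map_sub (primitiveAt x) w z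

lemma primitive_eq_inner (w : L2Unit) (x : ℝ) :
    primitive w x = inner ℝ (indicatorConstLp 2 (measurableSet_Iic (a := x))
      (measure_ne_top unitMeasure _) (1 : ℝ)) w := by
  rw [L2.inner_indicatorConstLp_one]; rfl

lemma abs_setIntegral_le (w : L2Unit) {s : Set ℝ} (hs : MeasurableSet s) :
    |∫ t in s, w t ∂unitMeasure| ≤ ‖w‖ * √(unitMeasure.real s) := by
  rw [← L2.inner_indicatorConstLp_one (𝕜 := ℝ) hs (measure_ne_top unitMeasure s) w]
  refine (abs_real_inner_le_norm _ _).trans ?_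
  rw [norm_indicatorConstLp (by simp) (by simp), mul_comm]
  simp [Real.sqrt_eq_rpow]

lemma abs_primitive_le (w : L2Unit) (x : ℝ) : |primitive w x| ≤ ‖w‖ := by
  refine (abs_setIntegral_le w measurableSet_Iic).trans ?_
  have : √(unitMeasure.real (Iic x)) ≤ 1 := by
    rw [Real.sqrt_le_one]; exact measureReal_le_one
  nlinarith [norm_nonneg w]

lemma abs_primitive_sub_le (w : L2Unit) (x y : ℝ) :
    |primitive w y - primitive w x| ≤ ‖w‖ * √|y - x| := by
  wlog h : x ≤ y generalizing x y
  · rw [abs_sub_comm, abs_sub_comm y x]; exact this y x (le_of_not_ge h)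
  rw [primitive_sub_primitive w.integrable h]
  refine (abs_setIntegral_le w measurableSet_Ioc).trans ?_
  gcongr
  rw [abs_of_nonneg (sub_nonneg.2 h)]
  have h1 : unitMeasure.real (Ioc x y) ≤ volume.real (Ioc x y) :=
    ENNReal.toReal_mono (by simp) (Measure.restrict_apply_le _ _)
  simpa [h] using h1

/-- The one-dimensional Sobolev inequality with small constant in front of the derivative. -/
lemma sq_primitive_le (w : L2Unit) {ε : ℝ} (hε : 0 < ε) {x : ℝ} (hx : x ∈ Icc (0 : ℝ) 1) :
    primitive w x ^ 2 ≤ ε * ‖w‖ ^ 2 + ε⁻¹ * ∫ t, primitive w t ^ 2 ∂unitMeasure := by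
  have hc := continuous_primitive w.integrable
  have h := integral_mul_primitive_add w.integrable w.integrable hx
  -- W(x)² is the integral of 2 w W over [0, x]; the weighted Young inequality bounds the integrand,
  -- and the bound is nonnegative, so the integral may be extended to [0, 1].
  rw [sq, ← h, ← real_inner_self_eq_norm_sq, L2Unit.inner_eq, ← integral_const_mul,
    ← integral_const_mul, ← integral_add (((w.integrable_mul w).const_mul _))
      (Integrable.const_mul (f := fun t => primitive w t ^ 2)
        (integrable_unit_of_continuous (hc.pow 2)) _)]
  have hi : Integrable (fun t => w t * primitive w t + primitive w t * w t) unitMeasure := by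
    have := integrable_mul_continuous w.integrable hc
    refine this.add ?_
    simpa only [mul_comm] using this
  have hi2 : Integrable (fun t => ε * (w t * w t) + ε⁻¹ * primitive w t ^ 2) unitMeasure :=
    ((w.integrable_mul w).const_mul _).add
      ((integrable_unit_of_continuous (hc.pow 2)).const_mul _)
  have key : ∀ a b : ℝ, a * b + b * a ≤ ε * (a * a) + ε⁻¹ * b ^ 2 := fun a b => by
    have : ε * (a * a) + ε⁻¹ * b ^ 2 - (a * b + b * a) = ε⁻¹ * (ε * a - b) ^ 2 := by
      field_simp; ring
    have h2 : 0 ≤ ε⁻¹ * (ε * a - b) ^ 2 := by positivity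
    linarith
  have key0 : ∀ a b : ℝ, 0 ≤ ε * (a * a) + ε⁻¹ * b ^ 2 := fun a b => by
    have := mul_self_nonneg a
    positivity
  refine (setIntegral_mono hi.integrableOn hi2.integrableOn (fun t => key _ _)).trans ?_
  exact setIntegral_le_integral hi2 (Eventually.of_forall fun t => key0 _ _)

/-! ### Weak limits and uniform convergence of primitives -/

lemma exists_tendsto_of_abs_le {ι : Type*} (U : Ultrafilter ι) {a : ι → ℝ} {C : ℝ}
    (h : ∀ i, |a i| ≤ C) : ∃ L, Tendsto a U (𝓝 L) := by
  obtain ⟨L, -, hL⟩ := isCompact_Icc.ultrafilter_le_nhds (s := Icc (-C) C) (U.map a) (by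
    simp only [Ultrafilter.coe_map, le_principal_iff, mem_map]
    exact Eventually.of_forall fun i => abs_le.1 (h i))
  exact ⟨L, hL⟩

/-- Bounded families in a real Hilbert space converge weakly along every ultrafilter. -/
lemma exists_weak_limit {ι E : Type*} [NormedAddCommGroup E] [InnerProductSpace ℝ E]
    [CompleteSpace E] (U : Ultrafilter ι) {w : ι → E} {C : ℝ} (h : ∀ i, ‖w i‖ ≤ C) :
    ∃ w₀ : E, ∀ z, Tendsto (fun i => inner ℝ (w i) z) U (𝓝 (inner ℝ w₀ z)) := by
  have hb : ∀ z i, |inner ℝ (w i) z| ≤ C * ‖z‖ := fun z i =>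
    (abs_real_inner_le_norm _ _).trans (by gcongr; exact h i)
  choose f hf using fun z => exists_tendsto_of_abs_le U (hb z)
  let g : E →ₗ[ℝ] ℝ :=
    { toFun := f
      map_add' := fun x y => tendsto_nhds_unique (hf (x + y)) (by
        simpa only [inner_add_right] using (hf x).add (hf y))
      map_smul' := fun c x => tendsto_nhds_unique (hf (c • x)) (by
        simpa only [inner_smul_right, smul_eq_mul, RingHom.id_apply] using (hf x).const_mul c) }
  let G : StrongDual ℝ E := g.mkContinuous C fun z =>
    le_of_tendsto (hf z).abs (Eventually.of_forall (hb z))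
  refine ⟨(InnerProductSpace.toDual ℝ E).symm G, fun z => ?_⟩
  rw [InnerProductSpace.toDual_symm_apply]
  exact hf z

/-- Weak lower semicontinuity of the norm: expand ‖w i - w₀‖² ≥ 0 and pass to the limit. -/
lemma norm_sq_le_of_weak_limit {ι E : Type*} [NormedAddCommGroup E] [InnerProductSpace ℝ E]
    {l : Filter ι} [l.NeBot] {w : ι → E} {w₀ : E} {L : ℝ}
    (hw : ∀ z, Tendsto (fun i => inner ℝ (w i) z) l (𝓝 (inner ℝ w₀ z)))
    (hL : Tendsto (fun i => ‖w i‖ ^ 2) l (𝓝 L)) : ‖w₀‖ ^ 2 ≤ L := by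
  have h1 : Tendsto (fun i => ‖w i - w₀‖ ^ 2) l (𝓝 (L - 2 * ‖w₀‖ ^ 2 + ‖w₀‖ ^ 2)) := by
    simp only [norm_sub_sq_real]
    refine (hL.sub ?_).add tendsto_const_nhds
    rw [← real_inner_self_eq_norm_sq]
    exact (hw w₀).const_mul 2
  have := ge_of_tendsto h1 (Eventually.of_forall fun i => sq_nonneg _)
  linarith

/-- Weak convergence of bounded derivatives implies uniform convergence of the primitives. -/
lemma tendstoUniformlyOn_primitive {ι : Type*} {l : Filter ι} {w : ι → L2Unit} {w₀ : L2Unit}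
    {C : ℝ} (hC : ∀ i, ‖w i‖ ≤ C)
    (hw : ∀ z, Tendsto (fun i => inner ℝ (w i) z) l (𝓝 (inner ℝ w₀ z))) :
    TendstoUniformlyOn (fun i => primitive (w i)) (primitive w₀) l (Icc 0 1) := by
  rw [Metric.tendstoUniformlyOn_iff]
  intro ε hε
  have hpt : ∀ x, Tendsto (fun i => primitive (w i) x) l (𝓝 (primitive w₀ x)) := fun x => by
    simp only [primitive_eq_inner]
    simpa only [real_inner_comm] using hw (indicatorConstLp 2 (measurableSet_Iic (a := x))
      (measure_ne_top unitMeasure _) (1 : ℝ))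
  -- The primitive of `w₀ - w i` is Hölder continuous of exponent 1/2 with constant at most M. With
  -- N > (4M/ε)² it varies by at most ε/4 from the grid point to the left, so pointwise convergence
  -- at the finitely many points j/N suffices.
  set M := |C| + ‖w₀‖ + 1 with hM
  have hMpos : 0 < M := by positivity
  obtain ⟨N, hN⟩ := exists_nat_gt ((4 * M / ε) ^ 2)
  have hNpos : (0 : ℝ) < N := lt_of_le_of_lt (sq_nonneg _) hN
  have hsqrt : M * √(1 / N) ≤ ε / 4 := by
    rw [Real.sqrt_div zero_le_one, Real.sqrt_one, mul_one_div, div_le_div_iff₀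
      (Real.sqrt_pos.2 hNpos) (by norm_num)]
    have : 4 * M / ε ≤ √N := Real.le_sqrt_of_sq_le hN.le
    rw [div_le_iff₀ hε] at this
    linarith
  have hgrid : ∀ᶠ i in l, ∀ j ∈ Finset.range (N + 1),
      dist (primitive w₀ (j / N)) (primitive (w i) (j / N)) < ε / 2 := by
    rw [eventually_all_finset]
    intro j _
    have := (Metric.tendsto_nhds.1 (hpt (j / N))) (ε / 2) (by positivity)
    simpa only [dist_comm] using this
  filter_upwards [hgrid] with i hi x hx
  have hj := Nat.floor_le (mul_nonneg hx.1 hNpos.le)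
  have hj2 := Nat.lt_floor_add_one (x * N)
  set j := ⌊x * N⌋₊
  have hjN : j ∈ Finset.range (N + 1) := by
    rw [Finset.mem_range, Nat.lt_succ_iff]
    have : (j : ℝ) ≤ N := hj.trans (by nlinarith [hx.2])
    exact_mod_cast this
  have hxj : |x - j / N| ≤ 1 / N := by
    have : x - j / N = (x * N - j) / N := by field_simp
    rw [this, abs_of_nonneg (div_nonneg (by linarith) hNpos.le)]
    gcongr
    linarith
  have hv := abs_primitive_sub_le (w₀ - w i) (j / N) x
  have hn : ‖w₀ - w i‖ ≤ M := by
    have := norm_sub_le w₀ (w i)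
    have h2 := (hC i).trans (le_abs_self C)
    linarith
  have hv2 : |primitive ↑(w₀ - w i) x - primitive ↑(w₀ - w i) (j / N)| ≤ ε / 4 :=
    hv.trans (le_trans (by gcongr) hsqrt)
  rw [primitive_coe_sub, primitive_coe_sub] at hv2
  have := hi j hjN
  rw [Real.dist_eq] at this ⊢
  rw [abs_lt] at *
  rw [abs_le] at hv2
  constructor <;> linarith [hv2.1, hv2.2, this.1, this.2]

lemma TendstoUniformlyOn.mul_of_bounded {ι α : Type*} {l : Filter ι} {s : Set α}
    {f g : ι → α → ℝ} {f₀ g₀ : α → ℝ} {C : ℝ} (hf : TendstoUniformlyOn f f₀ l s)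
    (hg : TendstoUniformlyOn g g₀ l s) (hf₀ : ∀ x ∈ s, |f₀ x| ≤ C) (hg₀ : ∀ x ∈ s, |g₀ x| ≤ C) :
    TendstoUniformlyOn (fun i x => f i x * g i x) (fun x => f₀ x * g₀ x) l s := by
  rw [Metric.tendstoUniformlyOn_iff] at *
  intro ε hε
  set M := |C| + 1
  have hM : 0 < M := by positivity
  set δ := min 1 (ε / (2 * M + 1)) with hδ
  have hδpos : 0 < δ := by positivity
  filter_upwards [hf δ hδpos, hg δ hδpos] with i h1 h2 x hx
  have a1 := (h1 x hx).le
  have a2 := (h2 x hx)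
  rw [Real.dist_eq] at *
  -- Only the limits are assumed bounded: every term contains a limit times an error, or two errors,
  -- one of which is at most 1.
  have e : f₀ x * g₀ x - f i x * g i x
      = f₀ x * (g₀ x - g i x) + (f₀ x - f i x) * g₀ x - (f₀ x - f i x) * (g₀ x - g i x) := by ring
  have b1 : |f₀ x * (g₀ x - g i x)| ≤ |C| * δ := by
    rw [abs_mul]
    exact mul_le_mul ((hf₀ x hx).trans (le_abs_self C)) a2.le (abs_nonneg _) (abs_nonneg _)
  have b2 : |(f₀ x - f i x) * g₀ x| ≤ δ * |C| := by
    rw [abs_mul]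
    exact mul_le_mul a1 ((hg₀ x hx).trans (le_abs_self C)) (abs_nonneg _) hδpos.le
  have b3 : |(f₀ x - f i x) * (g₀ x - g i x)| ≤ 1 * δ := by
    rw [abs_mul]
    have : |f₀ x - f i x| ≤ 1 := a1.trans (min_le_left _ _)
    gcongr
  have hδ2 : δ * (2 * M + 1) ≤ ε := by
    rw [← le_div_iff₀ (by positivity)]; exact min_le_right _ _
  have hlt : |C| * δ + δ * |C| + 1 * δ < δ * (2 * M + 1) := by
    have : δ * (2 * M + 1) = |C| * δ + δ * |C| + 1 * δ + 2 * δ := by simp only [M]; ring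
    linarith
  calc _ ≤ |f₀ x * (g₀ x - g i x) + (f₀ x - f i x) * g₀ x|
        + |(f₀ x - f i x) * (g₀ x - g i x)| := by rw [e]; exact abs_sub _ _
    _ ≤ |f₀ x * (g₀ x - g i x)| + |(f₀ x - f i x) * g₀ x|
        + |(f₀ x - f i x) * (g₀ x - g i x)| := by gcongr; exact abs_add_le _ _
    _ < _ := by linarith

lemma tendstoUniformlyOn_primitive_mul {ι : Type*} {l : Filter ι} {w z : ι → L2Unit}
    {w₀ z₀ : L2Unit}
    (hw : TendstoUniformlyOn (fun i => primitive (w i)) (primitive w₀) l (Icc 0 1))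
    (hz : TendstoUniformlyOn (fun i => primitive (z i)) (primitive z₀) l (Icc 0 1)) :
    TendstoUniformlyOn (fun i x => primitive (w i) x * primitive (z i) x)
      (fun x => primitive w₀ x * primitive z₀ x) l (Icc 0 1) :=
  hw.mul_of_bounded (C := max ‖w₀‖ ‖z₀‖) hz
    (fun x _ => (abs_primitive_le w₀ x).trans (le_max_left _ _))
    (fun x _ => (abs_primitive_le z₀ x).trans (le_max_right _ _))

lemma abs_integral_mul_le {q f : ℝ → ℝ} (hq : Integrable q unitMeasure) {M : ℝ}
    (hf : ∀ x ∈ Icc (0 : ℝ) 1, |f x| ≤ M) :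
    |∫ x, q x * f x ∂unitMeasure| ≤ (∫ x, |q x| ∂unitMeasure) * M := by
  rw [← integral_mul_const, ← Real.norm_eq_abs]
  refine norm_integral_le_of_norm_le (hq.abs.mul_const M) ?_
  filter_upwards [ae_restrict_mem measurableSet_Icc] with x hx
  rw [Real.norm_eq_abs, abs_mul]
  exact mul_le_mul_of_nonneg_left (hf x hx) (abs_nonneg _)

/-- Potentials bounded in `L¹` applied to uniformly convergent functions. -/
lemma tendsto_integral_mul_sub {ι : Type*} {l : Filter ι} {q f : ι → ℝ → ℝ} {f₀ : ℝ → ℝ} {R : ℝ}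
    (hq : ∀ i, Integrable (q i) unitMeasure) (hR : ∀ i, ∫ x, |q i x| ∂unitMeasure ≤ R)
    (hf : ∀ i, Continuous (f i)) (hf₀ : Continuous f₀)
    (h : TendstoUniformlyOn f f₀ l (Icc 0 1)) :
    Tendsto (fun i => ∫ x, q i x * f i x ∂unitMeasure - ∫ x, q i x * f₀ x ∂unitMeasure)
      l (𝓝 0) := by
  rw [Metric.tendsto_nhds]
  intro ε hε
  rw [Metric.tendstoUniformlyOn_iff] at h
  filter_upwards [h (ε / (|R| + 1)) (by positivity)] with i hi
  rw [Real.dist_0_eq_abs, ← integral_sub (integrable_mul_continuous (hq i) (hf i))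
    (integrable_mul_continuous (hq i) hf₀)]
  simp only [← mul_sub]
  refine (abs_integral_mul_le (hq i) (M := ε / (|R| + 1)) fun x hx => ?_).trans_lt ?_
  · rw [abs_sub_comm]; exact (hi x hx).le
  · have h1 := (hR i).trans (le_abs_self R)
    have : |R| * (ε / (|R| + 1)) < ε := by
      rw [← mul_div_assoc, div_lt_iff₀ (by positivity)]
      nlinarith [abs_nonneg R]
    refine lt_of_le_of_lt ?_ this
    gcongr

lemma tendsto_integral_mul {ι : Type*} {l : Filter ι} {q : ℝ → ℝ} {f : ι → ℝ → ℝ} {f₀ : ℝ → ℝ}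
    (hq : Integrable q unitMeasure)
    (hf : ∀ i, Continuous (f i)) (hf₀ : Continuous f₀)
    (h : TendstoUniformlyOn f f₀ l (Icc 0 1)) :
    Tendsto (fun i => ∫ x, q x * f i x ∂unitMeasure) l (𝓝 (∫ x, q x * f₀ x ∂unitMeasure)) := by
  have := tendsto_integral_mul_sub (fun _ => hq) (fun _ => le_refl _) hf hf₀ h
  simpa using this.add_const (∫ x, q x * f₀ x ∂unitMeasure)

lemma continuous_primitive_mul (w z : L2Unit) :
    Continuous (fun x => primitive w x * primitive z x) :=
  (continuous_primitive w.integrable).mul (continuous_primitive z.integrable)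

/-! ### The quadratic forms -/

/-- The form `(w, z) ↦ ∫ q W Z`, where `W`, `Z` are the primitives of `w`, `z`. -/
def potentialForm {q : ℝ → ℝ} (hq : Integrable q unitMeasure) : L2Unit →ₗ[ℝ] L2Unit →ₗ[ℝ] ℝ :=
  LinearMap.mk₂ ℝ (fun w z => ∫ x, q x * (primitive w x * primitive z x) ∂unitMeasure)
    (fun w w' z => by
      rw [← integral_add (integrable_mul_continuous hq (continuous_primitive_mul _ _))
        (integrable_mul_continuous hq (continuous_primitive_mul _ _))]
      simp only [primitive_coe_add, Pi.add_apply]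
      congr 1; ext x; ring)
    (fun c w z => by
      rw [smul_eq_mul, ← integral_const_mul]
      simp only [primitive_coe_smul, Pi.smul_apply, smul_eq_mul]
      congr 1; ext x; ring)
    (fun w z z' => by
      rw [← integral_add (integrable_mul_continuous hq (continuous_primitive_mul _ _))
        (integrable_mul_continuous hq (continuous_primitive_mul _ _))]
      simp only [primitive_coe_add, Pi.add_apply]
      congr 1; ext x; ring)
    (fun c w z => by
      rw [smul_eq_mul, ← integral_const_mul]
      simp only [primitive_coe_smul, Pi.smul_apply, smul_eq_mul]
      congr 1; ext x; ring)

lemma potentialForm_apply {q : ℝ → ℝ} (hq : Integrable q unitMeasure) (w z : L2Unit) :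
    potentialForm hq w z = ∫ x, q x * (primitive w x * primitive z x) ∂unitMeasure := rfl

lemma potentialForm_comm {q : ℝ → ℝ} (hq : Integrable q unitMeasure) (w z : L2Unit) :
    potentialForm hq w z = potentialForm hq z w := by
  simp only [potentialForm_apply, mul_comm]

/-- The form `(w, z) ↦ ∫ W Z`. -/
def massForm : L2Unit →ₗ[ℝ] L2Unit →ₗ[ℝ] ℝ :=
  potentialForm (q := fun _ => 1) (integrable_const 1)

lemma massForm_apply (w z : L2Unit) :
    massForm w z = ∫ x, primitive w x * primitive z x ∂unitMeasure := by
  simp [massForm, potentialForm_apply]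

lemma massForm_comm (w z : L2Unit) : massForm w z = massForm z w := potentialForm_comm _ w z

lemma massForm_self (w : L2Unit) : massForm w w = ∫ x, primitive w x ^ 2 ∂unitMeasure := by
  simp only [massForm_apply, sq]

lemma massForm_self_nonneg (w : L2Unit) : 0 ≤ massForm w w := by
  rw [massForm_self]; exact integral_nonneg fun x => sq_nonneg _

/-- The form `(w, z) ↦ ∫ w z + ∫ q W Z`. -/
def energyForm {q : ℝ → ℝ} (hq : Integrable q unitMeasure) : L2Unit →ₗ[ℝ] L2Unit →ₗ[ℝ] ℝ :=
  innerₗ L2Unit + potentialForm hq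

lemma energyForm_apply {q : ℝ → ℝ} (hq : Integrable q unitMeasure) (w z : L2Unit) :
    energyForm hq w z = inner ℝ w z + potentialForm hq w z := rfl

lemma energyForm_comm {q : ℝ → ℝ} (hq : Integrable q unitMeasure) (w z : L2Unit) :
    energyForm hq w z = energyForm hq z w := by
  rw [energyForm_apply, energyForm_apply, potentialForm_comm, real_inner_comm]

lemma sq_primitive_le_massForm (w : L2Unit) {ε : ℝ} (hε : 0 < ε) {x : ℝ}
    (hx : x ∈ Icc (0 : ℝ) 1) :
    primitive w x ^ 2 ≤ ε * ‖w‖ ^ 2 + ε⁻¹ * massForm w w := by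
  rw [massForm_self]; exact sq_primitive_le w hε hx

/-- With zero mass the Sobolev inequality leaves only ε‖w‖², and ε is arbitrary. -/
lemma primitive_eq_zero_of_massForm_eq_zero {w : L2Unit} (h : massForm w w = 0) {x : ℝ}
    (hx : x ∈ Icc (0 : ℝ) 1) : primitive w x = 0 := by
  have h1 : ∀ ε : ℝ, 0 < ε → primitive w x ^ 2 ≤ ε := fun ε hε => by
    have := sq_primitive_le_massForm w (ε := ε / (‖w‖ ^ 2 + 1)) (by positivity) hx
    rw [h, mul_zero, add_zero] at this
    refine this.trans ?_
    rw [div_mul_eq_mul_div, div_le_iff₀ (by positivity)]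
    nlinarith [sq_nonneg ‖w‖]
  have := le_of_forall_pos_le_add (a := primitive w x ^ 2) (b := 0)
    (fun ε hε => by simpa using h1 ε hε)
  nlinarith [sq_nonneg (primitive w x)]

/-- Coercivity up to a multiple of the mass. The Sobolev parameter 1/(2R) makes the potential term
cost exactly half of ‖w‖². The constants depend on q only through R, which makes later bounds
uniform over the ball. -/
lemma energyForm_self_ge {q : ℝ → ℝ} (hq : Integrable q unitMeasure) {R : ℝ} (hRpos : 0 < R)
    (hR : ∫ x, |q x| ∂unitMeasure ≤ R) (w : L2Unit) :
    2⁻¹ * ‖w‖ ^ 2 - 2 * R ^ 2 * massForm w w ≤ energyForm hq w w := by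
  have h := abs_integral_mul_le hq (f := fun x => primitive w x * primitive w x)
    (M := (2 * R)⁻¹ * ‖w‖ ^ 2 + (2 * R) * massForm w w) (fun x hx => by
      rw [abs_mul_self, ← sq]
      simpa using sq_primitive_le_massForm w (ε := (2 * R)⁻¹) (by positivity) hx)
  have hnn : 0 ≤ (2 * R)⁻¹ * ‖w‖ ^ 2 + (2 * R) * massForm w w := by
    have := massForm_self_nonneg w
    positivity
  have h2 := h.trans (mul_le_mul_of_nonneg_right hR hnn)
  have h3 : R * ((2 * R)⁻¹ * ‖w‖ ^ 2 + (2 * R) * massForm w w)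
      = 2⁻¹ * ‖w‖ ^ 2 + 2 * R ^ 2 * massForm w w := by field_simp
  rw [h3] at h2
  have h4 := (abs_le.1 h2).1
  rw [energyForm_apply, potentialForm_apply, real_inner_self_eq_norm_sq]
  linarith

lemma memLp_of_continuousOn_unit {f : ℝ → ℝ} (hf : ContinuousOn f (Icc 0 1)) (p : ENNReal) :
    MemLp f p unitMeasure := by
  obtain ⟨C, hC⟩ := isCompact_Icc.exists_bound_of_continuousOn hf
  refine MemLp.of_bound (hf.aestronglyMeasurable measurableSet_Icc) C ?_
  filter_upwards [ae_restrict_mem measurableSet_Icc] with x hx using hC x hx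

/-! ### Trial functions and constrained energy minimizers -/

/-- The derivatives of functions in `H¹₀(0, 1)`. -/
def dirichletSpace : Submodule ℝ L2Unit := LinearMap.ker (primitiveAt 1)

lemma mem_dirichletSpace {w : L2Unit} : w ∈ dirichletSpace ↔ primitive w 1 = 0 := Iff.rfl

/-- The derivative of `x (1 - x) p(x)` as an element of `L²`. -/
def polynomialTrial : Polynomial ℝ →ₗ[ℝ] L2Unit where
  toFun p := MemLp.toLp (fun x => (Polynomial.derivative
      (Polynomial.X * (1 - Polynomial.X) * p)).eval x)
    (memLp_of_continuousOn_unit (Polynomial.continuous _).continuousOn 2)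
  map_add' p q := by
    rw [← MemLp.toLp_add]
    congr 1
    ext x
    simp only [mul_add, Polynomial.derivative_add, Polynomial.eval_add, Pi.add_apply]
  map_smul' c p := by
    rw [RingHom.id_apply, ← MemLp.toLp_const_smul]
    congr 1
    ext x
    simp only [mul_smul_comm, Polynomial.derivative_smul, Polynomial.eval_smul, Pi.smul_apply]

lemma primitive_polynomialTrial (p : Polynomial ℝ) {x : ℝ} (hx : x ∈ Icc (0 : ℝ) 1) :
    primitive (polynomialTrial p) x = x * (1 - x) * p.eval x := by
  set P := Polynomial.X * (1 - Polynomial.X) * p with hP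
  have h1 : (polynomialTrial p : ℝ → ℝ) =ᵐ[unitMeasure] fun x => P.derivative.eval x :=
    MemLp.coeFn_toLp (memLp_of_continuousOn_unit (Polynomial.continuous _).continuousOn 2)
  rw [primitive_congr h1, primitive_eq_intervalIntegral]
  have h2 : ∫ t in (0 : ℝ)..x, (Icc (0 : ℝ) 1).indicator (fun x => P.derivative.eval x) t
      = ∫ t in (0 : ℝ)..x, P.derivative.eval t := by
    apply intervalIntegral.integral_congr
    intro t ht
    rw [uIcc_of_le hx.1] at ht
    exact indicator_of_mem (s := Icc (0 : ℝ) 1) ⟨ht.1, ht.2.trans hx.2⟩ _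
  rw [h2, intervalIntegral.integral_eq_sub_of_hasDerivAt (fun t _ => P.hasDerivAt t)
    ((Polynomial.continuous _).intervalIntegrable _ _)]
  simp [hP]

/-- There are nonzero trial functions orthogonal to any given finite family. -/
lemma exists_mem_dirichletSpace_orthogonal {ι : Type*} [Finite ι] (F : ι → L2Unit) :
    ∃ w ∈ dirichletSpace, (∀ j, massForm w (F j) = 0) ∧ massForm w w ≠ 0 := by
  let L : Polynomial ℝ →ₗ[ℝ] (ι → ℝ) :=
    LinearMap.pi fun j => (massForm.flip (F j)) ∘ₗ polynomialTrial
  -- The polynomials have infinite dimension, so finitely many linear conditions have a nonzero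
  -- common solution.
  have hL : ¬ Function.Injective L := fun h =>
    Polynomial.not_finite (R := ℝ) (Module.Finite.of_injective L h)
  rw [← LinearMap.ker_eq_bot, Submodule.eq_bot_iff] at hL
  push Not at hL
  obtain ⟨p, hp, hp0⟩ := hL
  refine ⟨polynomialTrial p, ?_, fun j => congrFun hp j, fun h => hp0 ?_⟩
  · rw [mem_dirichletSpace, primitive_polynomialTrial p (by simp)]; simp
  · apply Polynomial.eq_zero_of_infinite_isRoot
    refine (Ioo_infinite (zero_lt_one' ℝ)).mono fun x hx => ?_
    have h1 := primitive_eq_zero_of_massForm_eq_zero h (Ioo_subset_Icc_self hx)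
    rw [primitive_polynomialTrial p (Ioo_subset_Icc_self hx)] at h1
    have : x * (1 - x) ≠ 0 := mul_ne_zero hx.1.ne' (sub_pos.2 hx.2).ne'
    simpa [this] using h1

/-- The energy has a minimizer on the unit sphere of the orthogonal complement of a finite
family of functions. -/
lemma exists_energy_minimizer {q : ℝ → ℝ} (hq : Integrable q unitMeasure) {ι : Type*} [Finite ι]
    (F : ι → L2Unit) :
    ∃ w ∈ dirichletSpace, (∀ j, massForm w (F j) = 0) ∧ massForm w w = 1 ∧
      ∀ z ∈ dirichletSpace, (∀ j, massForm z (F j) = 0) →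
        energyForm hq w w * massForm z z ≤ energyForm hq z z := by
  obtain ⟨R, hRpos, hR⟩ : ∃ R > 0, ∫ x, |q x| ∂unitMeasure ≤ R :=
    ⟨|∫ x, |q x| ∂unitMeasure| + 1, by positivity, by linarith [le_abs_self (∫ x, |q x| ∂unitMeasure)]⟩
  have hlow := energyForm_self_ge hq hRpos hR
  set S : Set L2Unit := {w | w ∈ dirichletSpace ∧ (∀ j, massForm w (F j) = 0) ∧ massForm w w = 1}
    with hS
  have hscale : ∀ z ∈ dirichletSpace, (∀ j, massForm z (F j) = 0) → massForm z z ≠ 0 →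
      (√(massForm z z))⁻¹ • z ∈ S := fun z hz hzF hz0 => by
    refine ⟨dirichletSpace.smul_mem _ hz, fun j => by simp [hzF j], ?_⟩
    have hpos : 0 < massForm z z := lt_of_le_of_ne (massForm_self_nonneg z) hz0.symm
    simp only [map_smul, LinearMap.smul_apply, smul_eq_mul]
    rw [← mul_assoc, ← mul_inv, Real.mul_self_sqrt hpos.le, inv_mul_cancel₀ hz0]
  obtain ⟨z₀, hz₀, hz₀F, hz₀b⟩ := exists_mem_dirichletSpace_orthogonal F
  set A : Set ℝ := (fun w => energyForm hq w w) '' S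
  have hA : A.Nonempty := ⟨_, _, hscale z₀ hz₀ hz₀F hz₀b, rfl⟩
  have hAb : BddBelow A := by
    refine ⟨-(2 * R ^ 2), ?_⟩
    rintro _ ⟨w, hw, rfl⟩
    have := hlow w
    rw [hw.2.2] at this
    dsimp only
    nlinarith [sq_nonneg ‖w‖]
  have hseq : ∀ k : ℕ, ∃ w ∈ S, energyForm hq w w < sInf A + 1 / ((k : ℝ) + 1) := fun k => by
    obtain ⟨_, ⟨w, hw, rfl⟩, h⟩ := exists_lt_of_csInf_lt hA
      (lt_add_of_pos_right (sInf A) (Nat.one_div_pos_of_nat (α := ℝ) (n := k)))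
    exact ⟨w, hw, h⟩
  choose w hwS hw using hseq
  have hwlow : ∀ k, sInf A ≤ energyForm hq (w k) (w k) := fun k => csInf_le hAb ⟨_, hwS k, rfl⟩
  have hwle : ∀ k, energyForm hq (w k) (w k) ≤ sInf A + 1 := fun k => (hw k).le.trans (by
    gcongr
    rw [div_le_one (by positivity)]
    linarith [(Nat.cast_nonneg k : (0 : ℝ) ≤ k)])
  -- Coercivity bounds the minimizing sequence, since its masses are 1 and its energies are at most
  -- `sInf A + 1`.
  have hbd : ∀ k, ‖w k‖ ≤ √(2 * (sInf A + 1 + 2 * R ^ 2)) := fun k => by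
    apply Real.le_sqrt_of_sq_le
    have := hlow (w k)
    rw [(hwS k).2.2] at this
    linarith [hwle k]
  obtain ⟨w₀, hw₀⟩ := exists_weak_limit (hyperfilter ℕ) hbd
  have hu := tendstoUniformlyOn_primitive hbd hw₀
  have hlim : Tendsto (fun k => energyForm hq (w k) (w k)) (hyperfilter ℕ) (𝓝 (sInf A)) := by
    refine Tendsto.mono_left ?_ Nat.hyperfilter_le_atTop
    refine tendsto_of_tendsto_of_tendsto_of_le_of_le tendsto_const_nhds
      ?_ hwlow (fun k => (hw k).le)
    simpa using tendsto_const_nhds.add (tendsto_one_div_add_atTop_nhds_zero_nat (𝕜 := ℝ))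
  have hpot : ∀ {q : ℝ → ℝ} (hq : Integrable q unitMeasure),
      Tendsto (fun k => potentialForm hq (w k) (w k)) (hyperfilter ℕ)
        (𝓝 (potentialForm hq w₀ w₀)) := fun hq =>
    tendsto_integral_mul hq (fun k => continuous_primitive_mul _ _)
      (continuous_primitive_mul _ _) (tendstoUniformlyOn_primitive_mul hu hu)
  have hpot2 : ∀ z, Tendsto (fun k => massForm (w k) z) (hyperfilter ℕ)
        (𝓝 (massForm w₀ z)) := fun z =>
    tendsto_integral_mul (integrable_const 1) (fun k => continuous_primitive_mul _ _)
      (continuous_primitive_mul _ _) (tendstoUniformlyOn_primitive_mul hu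
        (fun u hu => Eventually.of_forall fun k x _ => refl_mem_uniformity hu))
  have hw₀S : w₀ ∈ S := by
    refine ⟨?_, fun j => ?_, ?_⟩
    · rw [mem_dirichletSpace]
      refine tendsto_nhds_unique (hu.tendsto_at (x := 1) (by simp)) ?_
      refine tendsto_const_nhds.congr fun k => ?_
      exact (mem_dirichletSpace.1 (hwS k).1).symm
    · refine tendsto_nhds_unique (hpot2 (F j)) ?_
      exact tendsto_const_nhds.congr fun k => ((hwS k).2.1 j).symm
    · refine tendsto_nhds_unique (hpot (integrable_const 1)) ?_
      exact tendsto_const_nhds.congr fun k => ((hwS k).2.2).symm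
  -- The potential term converges because the primitives converge uniformly; for the kinetic term,
  -- weak lower semicontinuity of the norm is enough.
  have hmin : energyForm hq w₀ w₀ ≤ sInf A := by
    have h1 := norm_sq_le_of_weak_limit hw₀ (L := sInf A - potentialForm hq w₀ w₀) (by
      refine (hlim.sub (hpot hq)).congr fun k => ?_
      rw [energyForm_apply, real_inner_self_eq_norm_sq]; ring)
    rw [energyForm_apply, real_inner_self_eq_norm_sq]; linarith
  refine ⟨w₀, hw₀S.1, hw₀S.2.1, hw₀S.2.2, fun z hz hzF => ?_⟩
  by_cases hz0 : massForm z z = 0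
  · have := hlow z
    rw [hz0, mul_zero, sub_zero] at this
    rw [hz0, mul_zero]
    exact le_trans (by positivity) this
  · have hpos : 0 < massForm z z := lt_of_le_of_ne (massForm_self_nonneg z) (Ne.symm hz0)
    have h1 := hmin.trans (csInf_le hAb ⟨_, hscale z hz hzF hz0, rfl⟩)
    simp only [map_smul, LinearMap.smul_apply, smul_eq_mul] at h1
    rw [← mul_assoc, ← mul_inv, Real.mul_self_sqrt hpos.le, inv_mul_eq_div, le_div_iff₀ hpos] at h1
    exact h1

/-! ### Weak solutions from minimizers -/

/-- The weak form of the eigenvalue problem, for the derivative `w` of the eigenfunction. -/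
def IsWeakSolution {q : ℝ → ℝ} (hq : Integrable q unitMeasure) (lam : ℝ) (w : L2Unit) : Prop :=
  w ∈ dirichletSpace ∧ ∀ z ∈ dirichletSpace, energyForm hq w z = lam * massForm w z

lemma eq_zero_of_forall_quadratic_nonneg {A B : ℝ} (h : ∀ t : ℝ, 0 ≤ 2 * t * A + t ^ 2 * B) :
    A = 0 := by
  have hB : 0 ≤ B := by nlinarith [h 1, h (-1)]
  -- The quadratic is smallest at -A/B; using B + 1 avoids division by zero and still gives a
  -- negative value unless A = 0.
  have h1 := h (-A / (B + 1))
  have e : 2 * (-A / (B + 1)) * A + (-A / (B + 1)) ^ 2 * B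
      = -(A ^ 2 * (B + 2)) / (B + 1) ^ 2 := by field_simp; ring
  rw [e, neg_div, neg_nonneg, div_le_iff₀ (by positivity), zero_mul] at h1
  nlinarith [sq_nonneg A, mul_nonneg (sq_nonneg A) hB]

/-- Minimization over the orthogonal complement of finitely many eigenfunctions produces a further
eigenfunction. -/
lemma exists_next_weakSolution {q : ℝ → ℝ} (hq : Integrable q unitMeasure) {ι : Type*} [Fintype ι]
    [DecidableEq ι] (F : ι → L2Unit) (lam : ι → ℝ) (hF : ∀ j, IsWeakSolution hq (lam j) (F j))
    (horth : ∀ i j, massForm (F i) (F j) = if i = j then 1 else 0) :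
    ∃ (ν : ℝ) (w : L2Unit), IsWeakSolution hq ν w ∧ (∀ j, massForm w (F j) = 0) ∧
      massForm w w = 1 ∧
      ∀ z ∈ dirichletSpace, (∀ j, massForm z (F j) = 0) →
        ν * massForm z z ≤ energyForm hq z z := by
  obtain ⟨w, hw, hwF, hw1, hmin⟩ := exists_energy_minimizer hq F
  refine ⟨energyForm hq w w, w, ⟨hw, fun z hz => ?_⟩, hwF, hw1, hmin⟩
  set ν := energyForm hq w w
  -- First variation of the energy at the minimizer, for admissible directions z.
  have key : ∀ z ∈ dirichletSpace, (∀ j, massForm z (F j) = 0) →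
      energyForm hq w z = ν * massForm w z := fun z hz hzF => by
    rw [← sub_eq_zero]
    refine eq_zero_of_forall_quadratic_nonneg (B := energyForm hq z z - ν * massForm z z)
      fun t => ?_
    have := hmin (w + t • z) (dirichletSpace.add_mem hw (dirichletSpace.smul_mem t hz))
      (fun j => by simp [hwF j, hzF j])
    simp only [map_add, map_smul, LinearMap.add_apply, LinearMap.smul_apply, smul_eq_mul,
      energyForm_comm hq z w, massForm_comm z w, hw1] at this
    change ν * _ ≤ ν + _ + _ at this
    nlinarith
  -- An arbitrary direction is projected off the family. The removed part contributes nothing to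
  -- either side, because w is orthogonal to each `F j` and `F j` is itself a weak solution.
  set z' := z - ∑ j, massForm z (F j) • F j with hz'
  have h1 := key z' (dirichletSpace.sub_mem hz (dirichletSpace.sum_mem fun j _ =>
    dirichletSpace.smul_mem _ (hF j).1)) (fun i => by
      simp [hz', horth])
  have h2 : ∀ j, energyForm hq w (F j) = 0 := fun j => by
    rw [energyForm_comm, (hF j).2 w hw, massForm_comm, hwF j, mul_zero]
  simpa [hz', h2, hwF] using h1

/-! ### Weak solutions are Carathéodory solutions -/

lemma primitive_of_continuous {v : ℝ → ℝ} {x : ℝ} (hx : x ∈ Icc (0 : ℝ) 1) :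
    primitive v x = ∫ t in (0 : ℝ)..x, v t := by
  rw [primitive_eq_intervalIntegral]
  apply intervalIntegral.integral_congr
  intro t ht
  rw [uIcc_of_le hx.1] at ht
  exact indicator_of_mem (s := Icc (0 : ℝ) 1) ⟨ht.1, ht.2.trans hx.2⟩ _

lemma hasDerivWithinAt_primitive {f v : ℝ → ℝ} (hv : ContinuousOn v (Icc 0 1))
    (h : f =ᵐ[unitMeasure] v) {x : ℝ} (hx : x ∈ Icc (0 : ℝ) 1) :
    HasDerivWithinAt (primitive f) (v x) (Icc 0 1) x := by
  -- Extending v by constants outside [0, 1] makes it continuous on the line, so the fundamental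
  -- theorem of calculus also covers the endpoints.
  set V : ℝ → ℝ := IccExtend zero_le_one ((Icc (0 : ℝ) 1).domRestrict v) with hV
  have hVc : Continuous V := hv.domRestrict.Icc_extend'
  have hVv : ∀ t ∈ Icc (0 : ℝ) 1, V t = v t := fun t ht => by
    rw [hV, IccExtend_of_mem zero_le_one _ ht]; rfl
  have hfV : f =ᵐ[unitMeasure] V := by
    filter_upwards [h, ae_restrict_mem measurableSet_Icc] with t ht htm
    rw [ht, hVv t htm]
  rw [primitive_congr hfV, ← hVv x hx]
  have hd := (hVc.integral_hasStrictDerivAt 0 x).hasDerivAt.hasDerivWithinAt (s := Icc (0 : ℝ) 1)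
  exact hd.congr (fun t ht => primitive_of_continuous ht) (primitive_of_continuous hx)

/-- The second derivative `(q - λ) W` prescribed by the differential equation. -/
def secondDerivative (q : ℝ → ℝ) (lam : ℝ) (w : L2Unit) (x : ℝ) : ℝ :=
  (q x - lam) * primitive w x

lemma integrable_secondDerivative {q : ℝ → ℝ} (hq : Integrable q unitMeasure) (lam : ℝ)
    (w : L2Unit) : Integrable (secondDerivative q lam w) unitMeasure :=
  integrable_mul_continuous (hq.sub (integrable_const lam)) (continuous_primitive w.integrable)

lemma integral_secondDerivative_mul {q : ℝ → ℝ} (hq : Integrable q unitMeasure) (lam : ℝ)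
    (w z : L2Unit) : ∫ x, secondDerivative q lam w x * primitive z x ∂unitMeasure =
      potentialForm hq w z - lam * massForm w z := by
  rw [potentialForm_apply, massForm_apply, ← integral_const_mul, ← integral_sub
    (integrable_mul_continuous hq (continuous_primitive_mul _ _))
    ((integrable_unit_of_continuous (continuous_primitive_mul _ _)).const_mul _)]
  congr 1
  ext x
  simp only [secondDerivative]; ring

lemma primitive_secondDerivative_memLp {q : ℝ → ℝ} (hq : Integrable q unitMeasure) (lam : ℝ)
    (w : L2Unit) : MemLp (primitive (secondDerivative q lam w)) 2 unitMeasure :=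
  memLp_of_continuousOn_unit
    (continuous_primitive (integrable_secondDerivative hq lam w)).continuousOn 2

/-- A weak solution is a function whose derivative is absolutely continuous with the
second derivative that the equation prescribes. -/
lemma isWeakSolution_iff {q : ℝ → ℝ} (hq : Integrable q unitMeasure) {lam : ℝ} {w : L2Unit} :
    IsWeakSolution hq lam w ↔ w ∈ dirichletSpace ∧
      ∃ c : ℝ, w =ᵐ[unitMeasure] fun x => c + primitive (secondDerivative q lam w) x := by
  set g := secondDerivative q lam w with hg
  have hgi : Integrable g unitMeasure := integrable_secondDerivative hq lam w
  have hgc := continuous_primitive hgi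
  have hparts : ∀ z ∈ dirichletSpace, ∫ x, z x * primitive g x ∂unitMeasure =
      -(potentialForm hq w z - lam * massForm w z) := fun z hz => by
    rw [integral_mul_primitive z.integrable hgi, mem_dirichletSpace.1 hz, zero_mul, zero_sub,
      ← integral_secondDerivative_mul hq]
    simp only [mul_comm, hg]
  refine and_congr_right fun hw => ⟨fun h => ?_, ?_⟩
  -- The du Bois-Reymond argument: w - G is orthogonal to `dirichletSpace`, and so are the
  -- constants. Subtracting the mean c of w - G lands in `dirichletSpace`, so the difference is
  -- orthogonal to itself.
  · set G : L2Unit := MemLp.toLp _ (primitive_secondDerivative_memLp hq lam w) with hG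
    have hGg : (G : ℝ → ℝ) =ᵐ[unitMeasure] primitive g := MemLp.coeFn_toLp _
    set c : ℝ := primitive ↑(w - G) 1 with hc
    set K : L2Unit := MemLp.toLp (fun _ => c) (memLp_const c) with hK
    have hKc : (K : ℝ → ℝ) =ᵐ[unitMeasure] fun _ => c := MemLp.coeFn_toLp _
    have hin : ∀ z ∈ dirichletSpace, inner ℝ (w - G) z = 0 := fun z hz => by
      have h1 := h z hz
      rw [energyForm_apply] at h1
      have h2 : inner ℝ G z = -(potentialForm hq w z - lam * massForm w z) := by
        rw [← hparts z hz, L2Unit.inner_eq]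
        apply integral_congr_ae
        filter_upwards [hGg] with x hx
        rw [hx, mul_comm]
      rw [inner_sub_left, h2]; linarith
    have hKin : ∀ z ∈ dirichletSpace, inner ℝ K z = 0 := fun z hz => by
      have : inner ℝ K z = c * primitive z 1 := by
        rw [L2Unit.inner_eq, primitive_at_one, ← integral_const_mul]
        apply integral_congr_ae
        filter_upwards [hKc] with x hx
        rw [hx]
      rw [this, mem_dirichletSpace.1 hz, mul_zero]
    have hz : w - G - K ∈ dirichletSpace := by
      rw [mem_dirichletSpace, primitive_coe_sub, ← hc, primitive_at_one, integral_congr_ae hKc]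
      simp
    have h0 : w - G - K = 0 := by
      rw [← inner_self_eq_zero (𝕜 := ℝ), inner_sub_left, hin _ hz, hKin _ hz, sub_zero]
    have h1 : w = K + G := by rw [← sub_eq_zero, ← h0]; abel
    refine ⟨c, ?_⟩
    rw [h1]
    filter_upwards [Lp.coeFn_add K G, hKc, hGg] with x hx hx1 hx2
    rw [hx, Pi.add_apply, hx1, hx2]
  · rintro ⟨c, hc⟩ z hz
    have h1 : inner ℝ w z = c * primitive z 1 + ∫ x, z x * primitive g x ∂unitMeasure := by
      rw [L2Unit.inner_eq, primitive_at_one, ← integral_const_mul, ← integral_add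
        (z.integrable.const_mul c) (integrable_mul_continuous z.integrable hgc)]
      apply integral_congr_ae
      filter_upwards [hc] with x hx
      rw [hx]; ring
    rw [energyForm_apply, h1, hparts z hz, mem_dirichletSpace.1 hz]; ring

lemma IsWeakSolution.isDirichletSolution {q : ℝ → ℝ} {hq : Integrable q unitMeasure} {lam : ℝ}
    {w : L2Unit} (h : IsWeakSolution hq lam w) : IsDirichletSolution q lam (primitive w) := by
  obtain ⟨hw, c, hc⟩ := (isWeakSolution_iff hq).1 h
  have hgi := integrable_secondDerivative hq lam w
  refine ⟨⟨fun x => c + primitive (secondDerivative q lam w) x, fun x hx => ?_, ?_, ?_⟩,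
    primitive_at_zero _, mem_dirichletSpace.1 hw⟩
  · exact hasDerivWithinAt_primitive
      (continuous_const.add (continuous_primitive hgi)).continuousOn hc hx
  · have hconst : AbsolutelyContinuousOnInterval (fun _ : ℝ => c) 0 1 :=
      (LipschitzWith.const (α := ℝ) c).lipschitzOnWith.absolutelyContinuousOnInterval
    exact hconst.add (absolutelyContinuous_primitive hgi)
  · filter_upwards [ae_hasDerivAt_primitive hgi] with x hx
    refine ⟨_, hx.const_add c, ?_⟩
    rw [secondDerivative]; ring

lemma IsDirichletSolution.exists_weakSolution {q : ℝ → ℝ} (hq : Integrable q unitMeasure)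
    {lam : ℝ} {ψ : ℝ → ℝ} (h : IsDirichletSolution q lam ψ) :
    ∃ w : L2Unit, IsWeakSolution hq lam w ∧ ∀ x ∈ Icc (0 : ℝ) 1, primitive w x = ψ x := by
  obtain ⟨⟨v, hv, hvac, heq⟩, h0, h1⟩ := h
  have hvc : ContinuousOn v (Icc 0 1) := by
    simpa [uIcc_of_le zero_le_one] using hvac.continuousOn
  set w : L2Unit := MemLp.toLp v (memLp_of_continuousOn_unit hvc 2) with hw
  have hwv : (w : ℝ → ℝ) =ᵐ[unitMeasure] v := MemLp.coeFn_toLp _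
  have hψ : ∀ x ∈ Icc (0 : ℝ) 1, primitive w x = ψ x := fun x hx => by
    have hsub : Icc 0 x ⊆ Icc (0 : ℝ) 1 := Icc_subset_Icc_right hx.2
    rw [primitive_congr hwv, primitive_of_continuous hx,
      intervalIntegral.integral_eq_sub_of_hasDerivAt_of_le hx.1
        (f := ψ) (f' := v), h0, sub_zero]
    · exact fun t ht => ((hv t (hsub ht)).continuousWithinAt).mono hsub
    · exact fun t ht => (hv t (hsub (Ioo_subset_Icc_self ht))).hasDerivAt
        (Icc_mem_nhds ht.1 (ht.2.trans_le hx.2))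
    · exact ContinuousOn.intervalIntegrable_of_Icc hx.1 (hvc.mono hsub)
  refine ⟨w, (isWeakSolution_iff hq).2 ⟨?_, v 0, ?_⟩, hψ⟩
  · rw [mem_dirichletSpace, hψ 1 (by simp), h1]
  · have hd : ∀ᵐ x ∂unitMeasure, HasDerivAt v (secondDerivative q lam w x) x := by
      filter_upwards [heq, ae_restrict_mem measurableSet_Icc] with x ⟨w', hw', hx⟩ hxm
      have : secondDerivative q lam w x = w' := by
        rw [secondDerivative, hψ x hxm]; linarith
      rwa [this]
    have h2 := (primitive_eq_of_absolutelyContinuous hvac hd).2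
    filter_upwards [hwv, ae_restrict_mem measurableSet_Icc] with x hx hxm
    rw [hx, h2 x hxm]

/-! ### Uniqueness for initial values and simplicity of eigenvalues -/

/-- A Volterra inequality has only the trivial solution. -/
lemma eq_zero_of_abs_le_primitive {k u : ℝ → ℝ} (hk : Integrable k unitMeasure)
    (hk0 : ∀ x, 0 ≤ k x) (hu : Continuous u)
    (h : ∀ x ∈ Icc (0 : ℝ) 1, |u x| ≤ primitive (fun t => k t * |u t|) x) :
    ∀ x ∈ Icc (0 : ℝ) 1, u x = 0 := by
  have hi : Integrable (fun t => k t * |u t|) unitMeasure := integrable_mul_continuous hk hu.abs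
  set Φ := primitive (fun t => k t * |u t|) with hΦ
  have hΦc : Continuous Φ := continuous_primitive hi
  have hmono : ∀ {x y : ℝ}, x ≤ y → Φ x ≤ Φ y := fun {x y} hxy => by
    rw [← sub_nonneg, hΦ, primitive_sub_primitive hi hxy]
    exact integral_nonneg fun t => mul_nonneg (hk0 t) (abs_nonneg _)
  -- Continuity induction: if Φ vanishes at x, then Φ t ≤ Φ t · ∫ₓᵗ k for t slightly to the right,
  -- where the integral of k is below 1/2, so Φ t = 0.
  have key : Icc (0 : ℝ) 1 ⊆ {x | Φ x = 0} := by
    refine IsClosed.Icc_subset_of_forall_exists_gt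
      (((isClosed_singleton (x := (0 : ℝ))).preimage hΦc).inter isClosed_Icc)
      (primitive_at_zero _) ?_
    rintro x ⟨hx0, hx⟩ y hy
    have hev : ∀ᶠ t in 𝓝[>] x, |primitive k t - primitive k x| < 2⁻¹ := by
      have := (continuous_primitive hk).tendsto x
      have h2 := (Metric.tendsto_nhds.1 this) 2⁻¹ (by norm_num)
      simp only [Real.dist_eq] at h2
      exact nhdsWithin_le_nhds h2
    have hev2 : ∀ᶠ t in 𝓝[>] x, t ∈ Ioc x (min y 1) :=
      Ioc_mem_nhdsGT (lt_min hy hx.2)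
    obtain ⟨t, ht1, ht2⟩ := (hev.and hev2).exists
    refine ⟨t, ?_, ht2.1, ht2.2.trans (min_le_left _ _)⟩
    have ht01 : t ≤ 1 := ht2.2.trans (min_le_right _ _)
    have h1 : Φ t - Φ x ≤ Φ t * (primitive k t - primitive k x) := by
      rw [hΦ, primitive_sub_primitive hi ht2.1.le, primitive_sub_primitive hk ht2.1.le, ← hΦ,
        ← integral_const_mul]
      refine setIntegral_mono_on hi.integrableOn (hk.const_mul _).integrableOn
        measurableSet_Ioc fun s hs => ?_
      rw [mul_comm]
      refine mul_le_mul_of_nonneg_right ?_ (hk0 s)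
      exact (h s ⟨hx.1.trans hs.1.le, hs.2.trans ht01⟩).trans (hmono hs.2)
    have hx0' : Φ x = 0 := hx0
    have h0 : 0 ≤ Φ t := hx0' ▸ hmono ht2.1.le
    have h3 : primitive k t - primitive k x ≤ 2⁻¹ := (abs_lt.1 ht1).2.le
    have := mul_le_mul_of_nonneg_left h3 h0
    change Φ t = 0
    linarith
  intro x hx
  have := h x hx
  rw [key hx] at this
  exact abs_nonpos_iff.1 this

lemma abs_primitive_le_primitive_abs {f : ℝ → ℝ} (x : ℝ) :
    |primitive f x| ≤ primitive (fun t => |f t|) x := by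
  simpa only [primitive, Real.norm_eq_abs] using
    norm_integral_le_integral_norm (μ := unitMeasure.restrict (Iic x)) f

/-- Solutions of the initial value problem with zero initial data vanish. -/
lemma eq_zero_of_initial_value {q u v : ℝ → ℝ} {lam : ℝ} (hq : Integrable q unitMeasure)
    (hu : Continuous u) (hv : Continuous v)
    (huv : ∀ x ∈ Icc (0 : ℝ) 1, u x = primitive v x)
    (hvu : ∀ x ∈ Icc (0 : ℝ) 1, v x = primitive (fun t => (q t - lam) * u t) x) :
    ∀ x ∈ Icc (0 : ℝ) 1, u x = 0 := by
  have hk : Integrable (fun t => |q t - lam|) unitMeasure := (hq.sub (integrable_const lam)).abs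
  have hi : Integrable (fun t => |q t - lam| * |u t|) unitMeasure :=
    integrable_mul_continuous hk hu.abs
  refine eq_zero_of_abs_le_primitive hk (fun t => abs_nonneg _) hu fun x hx => ?_
  rw [huv x hx]
  refine (abs_primitive_le_primitive_abs x).trans ?_
  set Φ := primitive (fun t => |q t - lam| * |u t|) with hΦ
  have hΦx : 0 ≤ Φ x := integral_nonneg fun t => mul_nonneg (abs_nonneg _) (abs_nonneg _)
  -- Φ is nondecreasing, so |v| ≤ Φ x on all of [0, x]. As [0, x] has length at most 1, integrating
  -- v once more costs nothing and the second-order problem becomes a scalar Volterra inequality.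
  have hb : ∀ t ∈ Icc (0 : ℝ) 1, t ≤ x → |v t| ≤ Φ x := fun t ht htx => by
    rw [hvu t ht]
    refine (abs_primitive_le_primitive_abs t).trans ?_
    simp only [abs_mul]
    rw [← hΦ, ← sub_nonneg, hΦ, primitive_sub_primitive hi htx]
    exact integral_nonneg fun s => mul_nonneg (abs_nonneg _) (abs_nonneg _)
  calc primitive (fun t => |v t|) x ≤ ∫ t in Iic x, Φ x ∂unitMeasure := by
        refine integral_mono_ae (integrable_unit_of_continuous hv.abs).integrableOn
          (integrable_const _) ?_
        filter_upwards [ae_restrict_mem measurableSet_Iic,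
          ae_restrict_of_ae (ae_restrict_mem measurableSet_Icc)] with t ht ht2
        exact hb t ht2 ht
    _ ≤ Φ x := by
        rw [setIntegral_const, smul_eq_mul]
        have : unitMeasure.real (Iic x) ≤ 1 := measureReal_le_one
        nlinarith

/-- Eigenvalues are simple. -/
lemma IsWeakSolution.massForm_self_eq_zero {q : ℝ → ℝ} {hq : Integrable q unitMeasure} {lam : ℝ}
    {w z : L2Unit} (hw : IsWeakSolution hq lam w) (hz : IsWeakSolution hq lam z)
    (hw0 : massForm w w ≠ 0) (hwz : massForm w z = 0) : massForm z z = 0 := by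
  obtain ⟨hwD, c, hc⟩ := (isWeakSolution_iff hq).1 hw
  obtain ⟨hzD, d, hd⟩ := (isWeakSolution_iff hq).1 hz
  -- The constants c and d are the derivatives of the two solutions at 0, so a combination with a c
  -- + b d = 0 has zero initial data and vanishes.
  have hcomb : ∀ a b : ℝ, a * c + b * d = 0 →
      ∀ x ∈ Icc (0 : ℝ) 1, a * primitive w x + b * primitive z x = 0 := fun a b hab => by
    have hgw := integrable_secondDerivative hq lam w
    have hgz := integrable_secondDerivative hq lam z
    have e : primitive (fun t => (q t - lam) * (a * primitive w t + b * primitive z t)) =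
        a • primitive (secondDerivative q lam w) + b • primitive (secondDerivative q lam z) := by
      rw [← primitive_smul, ← primitive_smul, ← primitive_add (hgw.smul a) (hgz.smul b)]
      congr 1
      ext t
      simp only [secondDerivative, Pi.add_apply, Pi.smul_apply, smul_eq_mul]; ring
    refine eq_zero_of_initial_value (lam := lam) hq
      (((continuous_primitive w.integrable).const_mul a).add
        ((continuous_primitive z.integrable).const_mul b))
      (v := a • primitive (secondDerivative q lam w) + b • primitive (secondDerivative q lam z))
      (((continuous_primitive hgw).const_smul a).add ((continuous_primitive hgz).const_smul b))
      (fun x hx => ?_) (fun x hx => by rw [e])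
    have e2 : a • (w : ℝ → ℝ) + b • (z : ℝ → ℝ) =ᵐ[unitMeasure]
        a • primitive (secondDerivative q lam w) + b • primitive (secondDerivative q lam z) := by
      filter_upwards [hc, hd] with t h1 h2
      simp only [Pi.add_apply, Pi.smul_apply, smul_eq_mul, h1, h2]
      linear_combination hab
    rw [← primitive_congr e2, primitive_add (w.integrable.smul a) (z.integrable.smul b),
      primitive_smul, primitive_smul]
    rfl
  have hmass : ∀ a b : ℝ, a * c + b * d = 0 → ∀ y, a * massForm w y + b * massForm z y = 0 :=
    fun a b hab y => by
      have h1 : massForm (a • w + b • z) y = 0 := by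
        rw [massForm_apply]
        rw [integral_congr_ae (g := fun _ => 0)]
        · simp
        · filter_upwards [ae_restrict_mem measurableSet_Icc] with x hx
          have := hcomb a b hab x hx
          simp only [primitive_coe_add, primitive_coe_smul, Pi.add_apply, Pi.smul_apply,
            smul_eq_mul, this, zero_mul]
      simpa using h1
  -- The coefficients (1, 0) show c ≠ 0. The coefficients (d, -c), tested against w, give d = 0 by
  -- orthogonality, and then (0, 1) is admissible and kills z.
  have hc0 : c ≠ 0 := fun hc0 => hw0 (by simpa using hmass 1 0 (by simp [hc0]) w)
  have hd0 : d = 0 := by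
    have := hmass d (-c) (by ring) w
    rw [massForm_comm z w, hwz] at this
    simpa [hw0] using this
  simpa using hmass 0 1 (by simp [hd0]) z

/-! ### Increasing enumeration of a discrete set -/

/-- An infinite set of reals with finitely many elements below every bound is enumerated
increasingly by the number of elements below. -/
lemma strictMono_enumeration {S : Set ℝ} (hinf : S.Infinite) (hfin : ∀ b, (S ∩ Iic b).Finite) :
    StrictMono (fun n : ℕ => sInf {s | s ∈ S ∧ {t | t ∈ S ∧ t < s}.encard = n}) ∧
    range (fun n : ℕ => sInf {s | s ∈ S ∧ {t | t ∈ S ∧ t < s}.encard = n}) = S ∧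
    Tendsto (fun n : ℕ => sInf {s | s ∈ S ∧ {t | t ∈ S ∧ t < s}.encard = n}) atTop atTop := by
  have hlt_fin : ∀ s, {t | t ∈ S ∧ t < s}.Finite := fun s =>
    (hfin s).subset fun t ht => ⟨ht.1, ht.2.le⟩
  have hmin : ∀ a : ℝ, ∃ s ∈ S, a < s ∧ ∀ t ∈ S, a < t → s ≤ t := fun a => by
    obtain ⟨b, hb, hab⟩ : ∃ b ∈ S, a < b := by
      by_contra! h
      exact hinf ((hfin a).subset fun t ht => ⟨ht, h t ht⟩)
    have hf : (S ∩ Ioc a b).Finite := (hfin b).subset fun t ht => ⟨ht.1, ht.2.2⟩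
    obtain ⟨s, hs, hle⟩ := Set.exists_min_image _ id hf ⟨b, hb, hab, le_rfl⟩
    refine ⟨s, hs.1, hs.2.1, fun t ht hat => ?_⟩
    rcases le_total t b with h | h
    · exact hle t ⟨ht, hat, h⟩
    · exact hs.2.2.trans h
  have hex : ∀ n : ℕ, ∃ s ∈ S, {t | t ∈ S ∧ t < s}.encard = n := fun n => by
    induction n with
    | zero =>
      obtain ⟨b, hb⟩ := hinf.nonempty
      obtain ⟨s, hs, hle⟩ := Set.exists_min_image _ id (hfin b)
        ⟨b, hb, le_refl b⟩
      refine ⟨s, hs.1, ?_⟩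
      rw [Nat.cast_zero, encard_eq_zero, eq_empty_iff_forall_notMem]
      rintro t ⟨ht, hts⟩
      exact absurd (hle t ⟨ht, hts.le.trans hs.2⟩) (not_le.2 hts)
    | succ n ih =>
      obtain ⟨s, hs, hn⟩ := ih
      obtain ⟨t, ht, hst, hle⟩ := hmin s
      refine ⟨t, ht, ?_⟩
      have : {x | x ∈ S ∧ x < t} = insert s {x | x ∈ S ∧ x < s} := by
        ext x
        constructor
        · rintro ⟨hx, hxt⟩
          rcases lt_trichotomy x s with h | h | h
          · exact Or.inr ⟨hx, h⟩
          · exact Or.inl h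
          · exact absurd (hle x hx h) (not_le.2 hxt)
        · rintro (rfl | ⟨hx, hxs⟩)
          · exact ⟨hs, hst⟩
          · exact ⟨hx, hxs.trans hst⟩
      rw [this, encard_insert_of_notMem (fun h => lt_irrefl s h.2), hn]
      rfl
  have hrank : ∀ s ∈ S, ∀ t, s < t →
      {x | x ∈ S ∧ x < s}.encard < {x | x ∈ S ∧ x < t}.encard := fun s hs t hst => by
    refine (hlt_fin s).encard_lt_encard ?_
    refine ⟨fun x hx => ⟨hx.1, hx.2.trans hst⟩, fun h => ?_⟩
    exact lt_irrefl s (h ⟨hs, hst⟩).2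
  choose e heS he using hex
  have huniq : ∀ (n : ℕ) s, s ∈ S → {t | t ∈ S ∧ t < s}.encard = n → s = e n := fun n s hs hn => by
    rcases lt_trichotomy s (e n) with h | h | h
    · have := hrank s hs _ h
      rw [hn, he] at this
      exact absurd this (lt_irrefl _)
    · exact h
    · have := hrank _ (heS n) _ h
      rw [hn, he] at this
      exact absurd this (lt_irrefl _)
  -- Each set under the infimum is a singleton, so no default value of `sInf` occurs.
  have heq : (fun n : ℕ => sInf {s | s ∈ S ∧ {t | t ∈ S ∧ t < s}.encard = n}) = e := by
    ext n
    have : {s | s ∈ S ∧ {t | t ∈ S ∧ t < s}.encard = n} = {e n} := by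
      ext s
      exact ⟨fun h => huniq n s h.1 h.2, fun h => by rw [h]; exact ⟨heS n, he n⟩⟩
    rw [this, csInf_singleton]
  rw [heq]
  have hmono : StrictMono e := fun n m hnm => by
    by_contra! h
    have h1 : {x | x ∈ S ∧ x < e m}.encard ≤ {x | x ∈ S ∧ x < e n}.encard :=
      encard_le_encard fun x hx => ⟨hx.1, hx.2.trans_le h⟩
    rw [he, he] at h1
    exact absurd (by exact_mod_cast h1) (not_le.2 hnm)
  refine ⟨hmono, ?_, ?_⟩
  · ext s
    constructor
    · rintro ⟨n, rfl⟩; exact heS n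
    · intro hs
      obtain ⟨n, hn⟩ := ENat.ne_top_iff_exists.1 (hlt_fin s).encard_lt_top.ne
      exact ⟨n, (huniq n s hs hn.symm).symm⟩
  · refine tendsto_atTop_atTop_of_monotone hmono.monotone fun b => ?_
    by_contra! h
    refine Set.infinite_range_of_injective hmono.injective ((hfin b).subset ?_)
    rintro _ ⟨n, rfl⟩
    exact ⟨heS n, (h n).le⟩



/-! ### The Dirichlet spectrum -/

lemma exists_integral_abs_le (q : ℝ → ℝ) : ∃ R > 0, ∫ x, |q x| ∂unitMeasure ≤ R :=
  ⟨|∫ x, |q x| ∂unitMeasure| + 1, by positivity,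
    by linarith [le_abs_self (∫ x, |q x| ∂unitMeasure)]⟩

lemma IsWeakSolution.smul {q : ℝ → ℝ} {hq : Integrable q unitMeasure} {lam : ℝ} {w : L2Unit}
    (h : IsWeakSolution hq lam w) (c : ℝ) : IsWeakSolution hq lam (c • w) :=
  ⟨dirichletSpace.smul_mem c h.1, fun z hz => by
    simp only [map_smul, LinearMap.smul_apply, h.2 z hz, smul_eq_mul]; ring⟩

lemma IsWeakSolution.add {q : ℝ → ℝ} {hq : Integrable q unitMeasure} {lam : ℝ} {w z : L2Unit}
    (hw : IsWeakSolution hq lam w) (hz : IsWeakSolution hq lam z) :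
    IsWeakSolution hq lam (w + z) :=
  ⟨dirichletSpace.add_mem hw.1 hz.1, fun y hy => by
    simp only [map_add, LinearMap.add_apply, hw.2 y hy, hz.2 y hy]; ring⟩

lemma isDirichletEigenvalue_iff {q : ℝ → ℝ} (hq : Integrable q unitMeasure) {lam : ℝ} :
    IsDirichletEigenvalue q lam ↔ ∃ w, IsWeakSolution hq lam w ∧ massForm w w = 1 := by
  constructor
  · rintro ⟨ψ, hψ, x, hx, hx0⟩
    obtain ⟨w, hw, hwψ⟩ := hψ.exists_weakSolution hq
    have h0 : massForm w w ≠ 0 := fun h =>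
      hx0 (by rw [← hwψ x hx, primitive_eq_zero_of_massForm_eq_zero h hx])
    have hpos : 0 < massForm w w := lt_of_le_of_ne (massForm_self_nonneg w) h0.symm
    refine ⟨(√(massForm w w))⁻¹ • w, hw.smul _, ?_⟩
    simp only [map_smul, LinearMap.smul_apply, smul_eq_mul]
    rw [← mul_assoc, ← mul_inv, Real.mul_self_sqrt hpos.le, inv_mul_cancel₀ h0]
  · rintro ⟨w, hw, hw1⟩
    refine ⟨primitive w, hw.isDirichletSolution, ?_⟩
    by_contra! h
    have : massForm w w = 0 := by
      rw [massForm_self, integral_congr_ae (g := fun _ => 0)]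
      · simp
      · filter_upwards [ae_restrict_mem measurableSet_Icc] with x hx
        rw [h x hx]; simp
    rw [this] at hw1
    exact zero_ne_one hw1

lemma IsWeakSolution.massForm_eq_zero {q : ℝ → ℝ} {hq : Integrable q unitMeasure} {lam ν : ℝ}
    {w z : L2Unit} (hw : IsWeakSolution hq lam w) (hz : IsWeakSolution hq ν z) (h : lam ≠ ν) :
    massForm w z = 0 := by
  have h1 := hw.2 z hz.1
  have h2 := hz.2 w hw.1
  rw [energyForm_comm, massForm_comm, h1] at h2
  have : (lam - ν) * massForm w z = 0 := by linarith
  exact (mul_eq_zero.1 this).resolve_left (sub_ne_zero.2 h)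

/-- Normalized eigenfunctions are bounded in `H¹` in terms of the eigenvalue and the `L¹` norm of
the potential. -/
lemma IsWeakSolution.norm_sq_le {q : ℝ → ℝ} {hq : Integrable q unitMeasure} {lam R : ℝ}
    {w : L2Unit} (hw : IsWeakSolution hq lam w) (hw1 : massForm w w = 1) (hRpos : 0 < R)
    (hR : ∫ x, |q x| ∂unitMeasure ≤ R) : ‖w‖ ^ 2 ≤ 2 * (lam + 2 * R ^ 2) := by
  have := energyForm_self_ge hq hRpos hR w
  rw [hw.2 w hw.1, hw1] at this
  linarith

lemma tendsto_massForm {ι : Type*} {l : Filter ι} {w z : ι → L2Unit} {w₀ z₀ : L2Unit}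
    (hw : TendstoUniformlyOn (fun i => primitive (w i)) (primitive w₀) l (Icc 0 1))
    (hz : TendstoUniformlyOn (fun i => primitive (z i)) (primitive z₀) l (Icc 0 1)) :
    Tendsto (fun i => massForm (w i) (z i)) l (𝓝 (massForm w₀ z₀)) :=
  tendsto_integral_mul (integrable_const 1) (fun _ => continuous_primitive_mul _ _)
    (continuous_primitive_mul _ _) (tendstoUniformlyOn_primitive_mul hw hz)

lemma tendstoUniformlyOn_const {ι α : Type*} (l : Filter ι) (f : α → ℝ) (s : Set α) :
    TendstoUniformlyOn (fun _ => f) f l s :=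
  fun _ hu => Eventually.of_forall fun _ _ _ => refl_mem_uniformity hu

/-- Infinitely many eigenvalues below b would give normalized eigenfunctions bounded in H¹. A limit
along an ultrafilter has mass 1 by uniform convergence, yet mutual orthogonality makes its mass 0.
-/
lemma finite_eigenvalues_le {q : ℝ → ℝ} (hq : Integrable q unitMeasure) (b : ℝ) :
    ({lam | IsDirichletEigenvalue q lam} ∩ Iic b).Finite := by
  by_contra hinf
  have hinf : ({lam | IsDirichletEigenvalue q lam} ∩ Iic b).Infinite := hinf
  set f := hinf.natEmbedding
  have hw : ∀ k, ∃ w, IsWeakSolution hq (f k) w ∧ massForm w w = 1 := fun k =>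
    (isDirichletEigenvalue_iff hq).1 (f k).2.1
  choose w hw hw1 using hw
  obtain ⟨R, hRpos, hR⟩ := exists_integral_abs_le q
  have hbd : ∀ k, ‖w k‖ ≤ √(2 * (b + 2 * R ^ 2)) := fun k => by
    apply Real.le_sqrt_of_sq_le
    have h1 := (hw k).norm_sq_le (hw1 k) hRpos hR
    have h2 : (f k : ℝ) ≤ b := (f k).2.2
    linarith
  obtain ⟨w₀, hw₀⟩ := exists_weak_limit (hyperfilter ℕ) hbd
  have hu := tendstoUniformlyOn_primitive hbd hw₀
  have h1 : massForm w₀ w₀ = 1 := by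
    refine tendsto_nhds_unique (tendsto_massForm hu hu) ?_
    exact tendsto_const_nhds.congr fun k => (hw1 k).symm
  have h2 : ∀ j, massForm (w j) w₀ = 0 := fun j => by
    refine tendsto_nhds_unique (tendsto_massForm (tendstoUniformlyOn_const _ _ _) hu) ?_
    refine tendsto_const_nhds.congr' ?_
    have : ∀ᶠ k in (hyperfilter ℕ : Filter ℕ), k ≠ j :=
      Nat.hyperfilter_le_atTop (eventually_ne_atTop j)
    filter_upwards [this] with k hk
    refine ((hw j).massForm_eq_zero (hw k) fun h => hk ?_).symm
    exact (f.injective (Subtype.ext h)).symm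
  have h3 : massForm w₀ w₀ = 0 := by
    refine tendsto_nhds_unique (tendsto_massForm hu (tendstoUniformlyOn_const _ _ _)) ?_
    exact tendsto_const_nhds.congr fun k => (h2 k).symm
  rw [h1] at h3
  exact one_ne_zero h3

/-- If there were finitely many, minimizing over the orthogonal complement of all the eigenfunctions
would give one more eigenfunction. Its eigenvalue is already on the list, so simplicity makes its
mass 0. -/
lemma infinite_eigenvalues {q : ℝ → ℝ} (hq : Integrable q unitMeasure) :
    {lam | IsDirichletEigenvalue q lam}.Infinite := by
  classical
  intro hfin
  have : Fintype {lam | IsDirichletEigenvalue q lam} := hfin.fintype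
  have hw : ∀ s : {lam | IsDirichletEigenvalue q lam},
      ∃ w, IsWeakSolution hq s w ∧ massForm w w = 1 := fun s =>
    (isDirichletEigenvalue_iff hq).1 s.2
  choose F hF hF1 using hw
  obtain ⟨ν, w, hw, hwF, hw1, -⟩ := exists_next_weakSolution hq F (fun s => (s : ℝ)) hF
    (fun i j => by
      split_ifs with h
      · rw [h, hF1]
      · exact (hF i).massForm_eq_zero (hF j) fun h2 => h (Subtype.ext h2))
  have hν : IsDirichletEigenvalue q ν := (isDirichletEigenvalue_iff hq).2 ⟨w, hw, hw1⟩
  have h0 := (hF ⟨ν, hν⟩).massForm_self_eq_zero (hz := hw) (by rw [hF1]; exact one_ne_zero)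
    (by rw [massForm_comm]; exact hwF _)
  rw [hw1] at h0
  exact one_ne_zero h0

/-- The eigenvalues of an integrable potential form an increasing sequence tending to infinity. -/
lemma dirichletEigenvalue_enumeration {q : ℝ → ℝ} (hq : Integrable q unitMeasure) :
    StrictMono (dirichletEigenvalue q) ∧
      range (dirichletEigenvalue q) = {lam | IsDirichletEigenvalue q lam} ∧
      Tendsto (dirichletEigenvalue q) atTop atTop :=
  strictMono_enumeration (infinite_eigenvalues hq) (finite_eigenvalues_le hq)

lemma exists_eigenvector {q : ℝ → ℝ} (hq : Integrable q unitMeasure) (n : ℕ) :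
    ∃ w, IsWeakSolution hq (dirichletEigenvalue q n) w ∧ massForm w w = 1 :=
  (isDirichletEigenvalue_iff hq).1
    ((dirichletEigenvalue_enumeration hq).2.1.subset (mem_range_self n))

/-- The derivative of a normalized eigenfunction for the `n`-th eigenvalue. -/
def eigenvector {q : ℝ → ℝ} (hq : Integrable q unitMeasure) (n : ℕ) : L2Unit :=
  (exists_eigenvector hq n).choose

lemma eigenvector_isWeakSolution {q : ℝ → ℝ} (hq : Integrable q unitMeasure) (n : ℕ) :
    IsWeakSolution hq (dirichletEigenvalue q n) (eigenvector hq n) :=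
  (exists_eigenvector hq n).choose_spec.1

lemma massForm_eigenvector_self {q : ℝ → ℝ} (hq : Integrable q unitMeasure) (n : ℕ) :
    massForm (eigenvector hq n) (eigenvector hq n) = 1 :=
  (exists_eigenvector hq n).choose_spec.2

lemma massForm_eigenvector {q : ℝ → ℝ} (hq : Integrable q unitMeasure) (i j : ℕ) :
    massForm (eigenvector hq i) (eigenvector hq j) = if i = j then 1 else 0 := by
  split_ifs with h
  · rw [h, massForm_eigenvector_self]
  · exact (eigenvector_isWeakSolution hq i).massForm_eq_zero (eigenvector_isWeakSolution hq j)
      ((dirichletEigenvalue_enumeration hq).1.injective.ne h)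

/-- The constrained minimum is an eigenvalue, and simplicity excludes indices below m, so it is at
least the eigenvalue of index m (counted from 0). -/
lemma dirichletEigenvalue_mul_massForm_le {q : ℝ → ℝ} (hq : Integrable q unitMeasure) (m : ℕ)
    {z : L2Unit} (hz : z ∈ dirichletSpace)
    (horth : ∀ j : Fin m, massForm z (eigenvector hq j) = 0) :
    dirichletEigenvalue q m * massForm z z ≤ energyForm hq z z := by
  obtain ⟨ν, w, hw, hwF, hw1, hmin⟩ := exists_next_weakSolution hq
    (fun j : Fin m => eigenvector hq j) (fun j => dirichletEigenvalue q j)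
    (fun j => eigenvector_isWeakSolution hq j)
    (fun i j => by simp only [massForm_eigenvector, Fin.ext_iff])
  have hν : IsDirichletEigenvalue q ν := (isDirichletEigenvalue_iff hq).2 ⟨w, hw, hw1⟩
  obtain ⟨k, rfl⟩ := (dirichletEigenvalue_enumeration hq).2.1.symm.subset hν
  have hk : m ≤ k := by
    by_contra! hk
    have h0 := (eigenvector_isWeakSolution hq k).massForm_self_eq_zero (hz := hw)
      (by rw [massForm_eigenvector_self]; exact one_ne_zero)
      (by rw [massForm_comm]; exact hwF ⟨k, hk⟩)
    rw [hw1] at h0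
    exact one_ne_zero h0
  refine le_trans ?_ (hmin z hz horth)
  exact mul_le_mul_of_nonneg_right ((dirichletEigenvalue_enumeration hq).1.monotone hk)
    (massForm_self_nonneg z)

/-! ### Ky Fan's inequality and the supergradient -/

/-- Bessel's inequality for the mass form. -/
lemma sum_sq_massForm_le {ι : Type*} [Fintype ι] [DecidableEq ι] (φ : ι → L2Unit)
    (hφ : ∀ i j, massForm (φ i) (φ j) = if i = j then 1 else 0) (z : L2Unit) :
    ∑ i, massForm z (φ i) ^ 2 ≤ massForm z z := by
  have h := massForm_self_nonneg (z - ∑ i, massForm z (φ i) • φ i)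
  have h1 : ∀ i, massForm (φ i) z = massForm z (φ i) := fun i => massForm_comm _ _
  simp only [map_sub, map_sum, map_smul, LinearMap.sub_apply, LinearMap.sum_apply,
    LinearMap.smul_apply, smul_eq_mul, hφ, h1, mul_ite, mul_one, mul_zero,
    Finset.sum_ite_eq', Finset.mem_univ, if_true, sub_self, Finset.sum_const_zero] at h
  simp only [sq]
  linarith

/-- Ky Fan's inequality for the sum of the lowest eigenvalues. -/
lemma eigenvalueSum_le_sum_energyForm {q : ℝ → ℝ} (hq : Integrable q unitMeasure) {m : ℕ}
    (φ : Fin m → L2Unit) (hφD : ∀ i, φ i ∈ dirichletSpace)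
    (hφ : ∀ i j, massForm (φ i) (φ j) = if i = j then 1 else 0) :
    eigenvalueSum m q ≤ ∑ i, energyForm hq (φ i) (φ i) := by
  set e : Fin m → L2Unit := fun j => eigenvector hq j with he
  set lam : Fin m → ℝ := fun j => dirichletEigenvalue q j with hlam
  set Λ := dirichletEigenvalue q m with hΛ
  have heo : ∀ i j, massForm (e i) (e j) = if i = j then 1 else 0 := fun i j => by
    simp only [he, massForm_eigenvector, Fin.ext_iff]
  have hlamΛ : ∀ j, lam j ≤ Λ := fun j =>
    (dirichletEigenvalue_enumeration hq).1.monotone j.2.le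
  -- Split `φ i` into its components along the first m eigenfunctions and a remainder z. Both forms
  -- split accordingly, and z has energy at least Λ times its mass.
  have h1 : ∀ i, Λ - ∑ j, (Λ - lam j) * massForm (φ i) (e j) ^ 2
      ≤ energyForm hq (φ i) (φ i) := fun i => by
    set c : Fin m → ℝ := fun j => massForm (φ i) (e j) with hc
    set z := φ i - ∑ j, c j • e j with hz
    have hzD : z ∈ dirichletSpace := dirichletSpace.sub_mem (hφD i)
      (dirichletSpace.sum_mem fun j _ => dirichletSpace.smul_mem _
        (eigenvector_isWeakSolution hq j).1)
    have hze : ∀ j, massForm z (e j) = 0 := fun j => by simp [hz, hc, heo]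
    have hae : ∀ j, energyForm hq (e j) z = 0 := fun j => by
      rw [(eigenvector_isWeakSolution hq j).2 z hzD, massForm_comm, hze, mul_zero]
    have haφ : ∀ j, energyForm hq (φ i) (e j) = lam j * c j := fun j => by
      rw [energyForm_comm, (eigenvector_isWeakSolution hq j).2 _ (hφD i), massForm_comm]
    have hbz : massForm z z = 1 - ∑ j, c j ^ 2 := by
      have : massForm z z = massForm z (φ i) := by
        refine (congrArg (massForm z) hz).trans ?_
        simp [hze]
      rw [this, hz, massForm_comm, map_sub, map_sum, hφ]
      simp [hc, sq]
    have haz : energyForm hq z z = energyForm hq (φ i) (φ i) - ∑ j, lam j * c j ^ 2 := by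
      have : energyForm hq z z = energyForm hq (φ i) z := by
        refine (congrArg (fun y => energyForm hq y z) hz).trans ?_
        simp [hae]
      rw [this, hz, map_sub, map_sum]
      simp only [map_smul, haφ, smul_eq_mul]
      congr 1
      exact Finset.sum_congr rfl fun j _ => by ring
    have := dirichletEigenvalue_mul_massForm_le hq m hzD hze
    rw [hbz, haz, mul_sub, mul_one, Finset.mul_sum] at this
    simp only [sub_mul, Finset.sum_sub_distrib]
    linarith
  have h2 : ∀ j, ∑ i, massForm (φ i) (e j) ^ 2 ≤ 1 := fun j => by
    have := sum_sq_massForm_le φ hφ (e j)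
    rw [heo, if_pos rfl] at this
    simpa only [massForm_comm (e j)] using this
  -- Exchange the sums: the weights Λ - λⱼ are nonnegative, and Bessel's inequality for `e j`
  -- against the family φ bounds each inner sum by 1.
  have h3 : ∑ i : Fin m, ∑ j, (Λ - lam j) * massForm (φ i) (e j) ^ 2 ≤ ∑ j, (Λ - lam j) := by
    rw [Finset.sum_comm]
    refine Finset.sum_le_sum fun j _ => ?_
    rw [← Finset.mul_sum]
    nlinarith [h2 j, hlamΛ j]
  have h4 := Finset.sum_le_sum fun i (_ : i ∈ Finset.univ) => h1 i
  rw [Finset.sum_sub_distrib] at h4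
  rw [Finset.sum_sub_distrib] at h3
  rw [eigenvalueSum, Finset.sum_range]
  linarith

/-- The sum of the squares of the first `m` normalized eigenfunctions. -/
def density {q : ℝ → ℝ} (hq : Integrable q unitMeasure) (m : ℕ) (x : ℝ) : ℝ :=
  ∑ i : Fin m, primitive (eigenvector hq i) x ^ 2

lemma continuous_density {q : ℝ → ℝ} (hq : Integrable q unitMeasure) (m : ℕ) :
    Continuous (density hq m) :=
  continuous_finsetSum _ fun _ _ => (continuous_primitive (L2Unit.integrable _)).pow 2

lemma density_nonneg {q : ℝ → ℝ} (hq : Integrable q unitMeasure) (m : ℕ) (x : ℝ) :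
    0 ≤ density hq m x := Finset.sum_nonneg fun _ _ => sq_nonneg _

lemma integral_mul_density {q : ℝ → ℝ} (hq : Integrable q unitMeasure) (m : ℕ) {f : ℝ → ℝ}
    (hf : Integrable f unitMeasure) : ∫ x, f x * density hq m x ∂unitMeasure =
      ∑ i : Fin m, potentialForm hf (eigenvector hq i) (eigenvector hq i) := by
  simp only [density, Finset.mul_sum, potentialForm_apply, ← sq]
  exact integral_finsetSum _ fun i _ => integrable_mul_continuous hf
    ((continuous_primitive (L2Unit.integrable _)).pow 2)

/-- The density is a supergradient of the sum of the lowest eigenvalues. -/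
lemma eigenvalueSum_le_add {q q₀ : ℝ → ℝ} (hq : Integrable q unitMeasure)
    (hq₀ : Integrable q₀ unitMeasure) (m : ℕ) : eigenvalueSum m q ≤
      eigenvalueSum m q₀ + ∫ x, (q x - q₀ x) * density hq₀ m x ∂unitMeasure := by
  -- The eigenfunctions of q₀ serve as trial functions for q.
  refine (eigenvalueSum_le_sum_energyForm hq (fun i : Fin m => eigenvector hq₀ i)
    (fun i => (eigenvector_isWeakSolution hq₀ i).1)
    (fun i j => by simp only [massForm_eigenvector, Fin.ext_iff])).trans_eq ?_
  have hd := integral_mul_density hq₀ m (hq.sub hq₀)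
  simp only [Pi.sub_apply] at hd
  rw [hd, eigenvalueSum, Finset.sum_range, ← Finset.sum_add_distrib]
  refine Finset.sum_congr rfl fun i _ => ?_
  have h1 := (eigenvector_isWeakSolution hq₀ i).2 _ (eigenvector_isWeakSolution hq₀ i).1
  rw [massForm_eigenvector_self, mul_one] at h1
  rw [← h1, energyForm_apply, energyForm_apply, add_assoc]
  congr 1
  simp only [potentialForm_apply]
  rw [← integral_add (integrable_mul_continuous hq₀ (continuous_primitive_mul _ _))
    (integrable_mul_continuous (hq.sub hq₀) (continuous_primitive_mul _ _))]
  congr 1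
  ext x
  simp only [Pi.sub_apply]; ring

/-! ### Uniform bounds and continuity of the density -/

/-- This is the supergradient inequality at the zero potential, whose density is bounded on [0, 1].
-/
lemma exists_eigenvalueSum_le (m : ℕ) (R : ℝ) : ∃ C, ∀ q : ℝ → ℝ, Integrable q unitMeasure →
    ∫ x, |q x| ∂unitMeasure ≤ R → eigenvalueSum m q ≤ C := by
  have h0 : Integrable (fun _ : ℝ => (0 : ℝ)) unitMeasure := integrable_const 0
  obtain ⟨M, hM⟩ := isCompact_Icc.exists_bound_of_continuousOn
    (continuous_density h0 m).continuousOn (s := Icc (0 : ℝ) 1)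
  refine ⟨eigenvalueSum m (fun _ => 0) + R * |M|, fun q hq hR => ?_⟩
  refine (eigenvalueSum_le_add hq h0 m).trans ?_
  gcongr
  simp only [sub_zero]
  refine (le_abs_self _).trans ((abs_integral_mul_le hq (M := |M|)
    fun x hx => (hM x hx).trans (le_abs_self M)).trans ?_)
  gcongr

lemma dirichletEigenvalue_ge {q : ℝ → ℝ} (hq : Integrable q unitMeasure) {R : ℝ} (hRpos : 0 < R)
    (hR : ∫ x, |q x| ∂unitMeasure ≤ R) (n : ℕ) : -(2 * R ^ 2) ≤ dirichletEigenvalue q n := by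
  have := (eigenvector_isWeakSolution hq n).norm_sq_le (massForm_eigenvector_self hq n) hRpos hR
  nlinarith [sq_nonneg ‖eigenvector hq n‖]

/-- The first `m` eigenvalues and normalized eigenfunctions are bounded uniformly over potentials
that are bounded in `L¹`. -/
lemma exists_eigenvector_bound (m : ℕ) {R : ℝ} (hRpos : 0 < R) : ∃ C, ∀ (q : ℝ → ℝ)
    (hq : Integrable q unitMeasure), ∫ x, |q x| ∂unitMeasure ≤ R → ∀ i < m,
      |dirichletEigenvalue q i| ≤ C ∧ ‖eigenvector hq i‖ ≤ C := by
  obtain ⟨C, hC⟩ := exists_eigenvalueSum_le m R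
  set B := |C| + 2 * (m + 1) * R ^ 2 with hB
  have hBpos : 0 ≤ B := by positivity
  refine ⟨2 * B + 1, fun q hq hR i hi => ?_⟩
  have hge := dirichletEigenvalue_ge hq hRpos hR
  -- After the shift by 2R² all eigenvalues are nonnegative, so each is at most the shifted sum.
  have h1 : dirichletEigenvalue q i + 2 * R ^ 2 ≤ C + m * (2 * R ^ 2) := by
    have h2 : dirichletEigenvalue q i + 2 * R ^ 2 ≤
        ∑ j ∈ Finset.range m, (dirichletEigenvalue q j + 2 * R ^ 2) :=
      Finset.single_le_sum (f := fun j => dirichletEigenvalue q j + 2 * R ^ 2)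
        (fun j _ => by linarith [hge j]) (Finset.mem_range.2 hi)
    rw [Finset.sum_add_distrib, Finset.sum_const, Finset.card_range, nsmul_eq_mul] at h2
    exact h2.trans (by gcongr; exact hC q hq hR)
  have h2 : dirichletEigenvalue q i + 2 * R ^ 2 ≤ B := by
    have := le_abs_self C
    have h3 : 0 ≤ R ^ 2 := by positivity
    rw [hB]; linarith
  have hR2 : 2 * R ^ 2 ≤ B := by
    have : 0 ≤ (m : ℝ) * R ^ 2 := by positivity
    have h3 := abs_nonneg C
    rw [hB]; linarith
  constructor
  · rw [abs_le]
    constructor <;> linarith [hge i, sq_nonneg R]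
  · have h3 := (eigenvector_isWeakSolution hq i).norm_sq_le (massForm_eigenvector_self hq i)
      hRpos hR
    nlinarith [norm_nonneg (eigenvector hq i)]

/-- Limits of eigenvalues and eigenfunctions along an ultrafilter. -/
lemma exists_eigenvector_limit {ι : Type*} (U : Ultrafilter ι) (m : ℕ) {q : ι → ℝ → ℝ} {R : ℝ}
    (hRpos : 0 < R) (hq : ∀ k, Integrable (q k) unitMeasure)
    (hR : ∀ k, ∫ x, |q k x| ∂unitMeasure ≤ R) :
    ∃ (ν : Fin m → ℝ) (w : Fin m → L2Unit),
      (∀ i : Fin m, Tendsto (fun k => dirichletEigenvalue (q k) i) U (𝓝 (ν i))) ∧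
      (∀ (i : Fin m) z, Tendsto (fun k => inner ℝ (eigenvector (hq k) i) z) U (𝓝 (inner ℝ (w i) z))) ∧
      (∀ i : Fin m, TendstoUniformlyOn (fun k => primitive (eigenvector (hq k) i)) (primitive (w i)) U
        (Icc 0 1)) ∧
      (∀ i, w i ∈ dirichletSpace) ∧
      ∀ i j, massForm (w i) (w j) = if i = j then 1 else 0 := by
  obtain ⟨C, hC⟩ := exists_eigenvector_bound m hRpos
  choose ν hν using fun i : Fin m => exists_tendsto_of_abs_le U
    (fun k => (hC (q k) (hq k) (hR k) i i.2).1)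
  choose w hw using fun i : Fin m => exists_weak_limit U
    (fun k => (hC (q k) (hq k) (hR k) i i.2).2)
  have hu : ∀ i : Fin m, TendstoUniformlyOn (fun k => primitive (eigenvector (hq k) i))
      (primitive (w i)) U (Icc 0 1) := fun i =>
    tendstoUniformlyOn_primitive (fun k => (hC (q k) (hq k) (hR k) i i.2).2) (hw i)
  refine ⟨ν, w, hν, hw, hu, fun i => ?_, fun i j => ?_⟩
  · rw [mem_dirichletSpace]
    refine tendsto_nhds_unique ((hu i).tendsto_at (x := 1) (by simp)) ?_
    exact tendsto_const_nhds.congr fun k =>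
      (mem_dirichletSpace.1 (eigenvector_isWeakSolution (hq k) i).1).symm
  · refine tendsto_nhds_unique (tendsto_massForm (hu i) (hu j)) ?_
    refine tendsto_const_nhds.congr fun k => ?_
    simp only [massForm_eigenvector, Fin.ext_iff]

lemma tendstoUniformlyOn_sum {ι α κ : Type*} {l : Filter ι} {s : Set α} (t : Finset κ)
    {f : κ → ι → α → ℝ} {f₀ : κ → α → ℝ} (h : ∀ j, TendstoUniformlyOn (f j) (f₀ j) l s) :
    TendstoUniformlyOn (fun i x => ∑ j ∈ t, f j i x) (fun x => ∑ j ∈ t, f₀ j x) l s := by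
  classical
  induction t using Finset.induction_on with
  | empty => simpa using tendstoUniformlyOn_const l (fun _ => 0) s
  | insert a t ha ih =>
    simp only [Finset.sum_insert ha]
    exact (h a).add ih

lemma tendstoUniformlyOn_density {ι : Type*} {l : Filter ι} {m : ℕ} {q : ι → ℝ → ℝ}
    (hq : ∀ k, Integrable (q k) unitMeasure) {w : Fin m → L2Unit}
    (hu : ∀ i : Fin m, TendstoUniformlyOn (fun k => primitive (eigenvector (hq k) i))
      (primitive (w i)) l (Icc 0 1)) :
    TendstoUniformlyOn (fun k => density (hq k) m) (fun x => ∑ i, primitive (w i) x ^ 2) l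
      (Icc 0 1) := by
  refine tendstoUniformlyOn_sum (f := fun (i : Fin m) k x => primitive (eigenvector (hq k) i) x ^ 2)
    Finset.univ fun i => ?_
  simpa only [sq] using tendstoUniformlyOn_primitive_mul (hu i) (hu i)

/-- The density depends continuously on the potential in `L¹`. -/
lemma tendstoUniformlyOn_density_of_tendsto {ι : Type*} (U : Ultrafilter ι) (m : ℕ)
    {q : ι → ℝ → ℝ} {q₀ : ℝ → ℝ} {R : ℝ} (hRpos : 0 < R)
    (hq : ∀ k, Integrable (q k) unitMeasure) (hR : ∀ k, ∫ x, |q k x| ∂unitMeasure ≤ R)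
    (hq₀ : Integrable q₀ unitMeasure)
    (hlim : Tendsto (fun k => ∫ x, |q k x - q₀ x| ∂unitMeasure) U (𝓝 0)) :
    TendstoUniformlyOn (fun k => density (hq k) m) (density hq₀ m) U (Icc 0 1) := by
  obtain ⟨ν, w, hν, hw, hu, hwD, horth⟩ := exists_eigenvector_limit U m hRpos hq hR
  have hlimf : ∀ f : ℝ → ℝ, Continuous f →
      Tendsto (fun k => ∫ x, (q k x - q₀ x) * f x ∂unitMeasure) U (𝓝 0) := fun f hf => by
    obtain ⟨M, hM⟩ := isCompact_Icc.exists_bound_of_continuousOn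
      hf.continuousOn (s := Icc (0 : ℝ) 1)
    refine squeeze_zero_norm (a := fun k => (∫ x, |q k x - q₀ x| ∂unitMeasure) * M)
      (fun k => abs_integral_mul_le ((hq k).sub hq₀) hM) ?_
    simpa using hlim.mul_const M
  -- The weak equation passes to the limit: weak convergence handles the kinetic term, L¹
  -- convergence of potentials with uniform convergence of primitives handles the rest.
  have hsol : ∀ i, IsWeakSolution hq₀ (ν i) (w i) := fun i => by
    refine ⟨hwD i, fun z hz => ?_⟩
    have h1 : Tendsto (fun k => potentialForm (hq k) (eigenvector (hq k) i) z) U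
        (𝓝 (potentialForm hq₀ (w i) z)) := by
      have a1 := tendsto_integral_mul_sub hq hR (fun k => continuous_primitive_mul _ _)
        (continuous_primitive_mul _ _)
        (tendstoUniformlyOn_primitive_mul (z := fun _ => z) (hu i)
          (tendstoUniformlyOn_const _ (primitive z) _))
      have a2 := hlimf _ (continuous_primitive_mul (w i) z)
      have a3 := (a1.add a2).add_const (potentialForm hq₀ (w i) z)
      simp only [add_zero, zero_add] at a3
      refine a3.congr fun k => ?_
      simp only [sub_mul, potentialForm_apply]
      rw [integral_sub (integrable_mul_continuous (hq k) (continuous_primitive_mul _ _))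
        (integrable_mul_continuous hq₀ (continuous_primitive_mul _ _))]
      ring
    have h2 : Tendsto (fun k => energyForm (hq k) (eigenvector (hq k) i) z) U
        (𝓝 (energyForm hq₀ (w i) z)) := (hw i z).add h1
    refine tendsto_nhds_unique h2 ?_
    refine ((hν i).mul (tendsto_massForm (z := fun _ => z) (hu i)
      (tendstoUniformlyOn_const _ (primitive z) _))).congr fun k => ?_
    exact ((eigenvector_isWeakSolution (hq k) i).2 z hz).symm
  -- The supergradient inequality at q₀ bounds the sum of the limits from above.
  have hle : ∑ i, ν i ≤ ∑ i : Fin m, dirichletEigenvalue q₀ i := by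
    have h1 : Tendsto (fun k => eigenvalueSum m (q k)) U (𝓝 (∑ i, ν i)) := by
      simp only [eigenvalueSum, Finset.sum_range]
      exact tendsto_finsetSum _ fun i _ => hν i
    have h2 := (hlimf _ (continuous_density hq₀ m)).const_add (eigenvalueSum m q₀)
    rw [add_zero] at h2
    have h3 := le_of_tendsto_of_tendsto' h1 h2 fun k => eigenvalueSum_le_add (hq k) hq₀ m
    rwa [eigenvalueSum, Finset.sum_range] at h3
  have hmono := (dirichletEigenvalue_enumeration hq₀).1
  -- Equal limits would contradict simplicity, since the limit eigenfunctions are orthonormal. Hence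
  -- the ν i are m distinct increasing eigenvalues of q₀, so ν i is at least the i-th one, and `hle`
  -- forces equality throughout.
  have hνmono : StrictMono ν := fun i j hij => by
    refine lt_of_le_of_ne (le_of_tendsto_of_tendsto' (hν i) (hν j) fun k =>
      (dirichletEigenvalue_enumeration (hq k)).1.monotone hij.le) fun h => ?_
    have h0 := (hsol i).massForm_self_eq_zero (hz := h ▸ hsol j)
      (by rw [horth, if_pos rfl]; exact one_ne_zero) (by rw [horth, if_neg hij.ne])
    rw [horth, if_pos rfl] at h0
    exact one_ne_zero h0
  have hσ : ∀ i, ∃ n, dirichletEigenvalue q₀ n = ν i := fun i =>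
    (dirichletEigenvalue_enumeration hq₀).2.1.symm.subset
      ((isDirichletEigenvalue_iff hq₀).2 ⟨w i, hsol i, by rw [horth, if_pos rfl]⟩)
  choose σ hσ using hσ
  have hσmono : StrictMono σ := fun i j hij => by
    rw [← hmono.lt_iff_lt, hσ, hσ]; exact hνmono hij
  have hσge : ∀ i : Fin m, (i : ℕ) ≤ σ i := by
    rintro ⟨i, hi⟩
    induction i with
    | zero => exact Nat.zero_le _
    | succ i ih =>
      have h1 := ih (by omega)
      have h2 := hσmono (a := ⟨i, by omega⟩) (b := ⟨i + 1, hi⟩) (by simp)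
      simp only at h1 h2 ⊢
      omega
  have hνge : ∀ i : Fin m, dirichletEigenvalue q₀ i ≤ ν i := fun i => by
    rw [← hσ]; exact hmono.monotone (hσge i)
  have hνeq : ∀ i : Fin m, dirichletEigenvalue q₀ i = ν i := fun i =>
    (Finset.sum_eq_sum_iff_of_le fun i _ => hνge i).1
      (le_antisymm (Finset.sum_le_sum fun i _ => hνge i) hle) i (Finset.mem_univ i)
  refine (tendstoUniformlyOn_density hq hu).congr_right fun x hx => ?_
  refine Finset.sum_congr rfl fun i _ => ?_
  have he := eigenvector_isWeakSolution hq₀ i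
  rw [hνeq i] at he
  set e := eigenvector hq₀ i
  have he1 : massForm e e = 1 := massForm_eigenvector_self hq₀ i
  have hw1 : massForm (w i) (w i) = 1 := by rw [horth, if_pos rfl]
  -- By simplicity, the part of `w i` orthogonal to e has zero mass. So the two normalized
  -- eigenfunctions agree up to the sign c, which disappears in the square.
  set c := massForm (w i) e with hc
  have hz := (hsol i).add (he.smul (-c))
  have hez : massForm e (w i + (-c) • e) = 0 := by
    simp [he1, massForm_comm e, hc]
  have h0 := he.massForm_self_eq_zero (hz := hz) (by rw [he1]; exact one_ne_zero) hez
  have hcc : c ^ 2 = 1 := by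
    simp only [map_add, map_smul, LinearMap.add_apply, LinearMap.smul_apply, smul_eq_mul, he1,
      massForm_comm e (w i), hw1, ← hc] at h0
    linarith
  have hp := primitive_eq_zero_of_massForm_eq_zero h0 hx
  rw [primitive_coe_add, primitive_coe_smul] at hp
  simp only [Pi.add_apply, Pi.smul_apply, smul_eq_mul] at hp
  have : primitive (w i) x = c * primitive e x := by linarith
  rw [this, mul_pow, hcc, one_mul]

/-! ### The ball of potentials and Hölder duality -/

/-- Functions `q` with `‖q‖_p ≤ r`. -/
def potentialBall (p r : ℝ) : Set (ℝ → ℝ) :=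
  {q | AEStronglyMeasurable q unitMeasure ∧ Integrable (fun x => |q x| ^ p) unitMeasure ∧
    ∫ x, |q x| ^ p ∂unitMeasure ≤ r ^ p}

lemma abs_le_one_add_rpow {p : ℝ} (hp : 1 ≤ p) (s : ℝ) : |s| ≤ 1 + |s| ^ p := by
  rcases le_total |s| 1 with h | h
  · have := Real.rpow_nonneg (abs_nonneg s) p
    linarith
  · have := Real.rpow_le_rpow_of_exponent_le h hp
    rw [Real.rpow_one] at this
    linarith

lemma potentialBall_integrable {p r : ℝ} (hp : 1 ≤ p) {q : ℝ → ℝ} (hq : q ∈ potentialBall p r) :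
    Integrable q unitMeasure := by
  refine ((integrable_const (1 : ℝ)).add hq.2.1).mono' hq.1 (Eventually.of_forall fun x => ?_)
  exact abs_le_one_add_rpow hp (q x)

lemma potentialBall_integral_abs_le {p r : ℝ} (hp : 1 ≤ p) {q : ℝ → ℝ}
    (hq : q ∈ potentialBall p r) : ∫ x, |q x| ∂unitMeasure ≤ 1 + r ^ p := by
  have h1 := integral_mono (potentialBall_integrable hp hq).abs
    ((integrable_const (1 : ℝ)).add hq.2.1) (fun x => abs_le_one_add_rpow hp (q x))
  refine h1.trans ?_
  simp only [Pi.add_apply]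
  rw [integral_add (integrable_const _) hq.2.1]
  simpa using hq.2.2

lemma neg_mem_potentialBall {p r : ℝ} {q : ℝ → ℝ} (hq : q ∈ potentialBall p r) :
    (fun x => -q x) ∈ potentialBall p r :=
  ⟨hq.1.neg, by simpa only [abs_neg] using hq.2.1, by simpa only [abs_neg] using hq.2.2⟩

/-- `|s|ᵖ` lies strictly above its tangents. -/
lemma rpow_tangent_lt {p : ℝ} (hp : 1 < p) {s t : ℝ} (ht : 0 ≤ t) (hst : s ≠ t) :
    t ^ p + p * t ^ (p - 1) * (s - t) < |s| ^ p := by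
  rcases ht.eq_or_lt with rfl | ht
  · rw [Real.zero_rpow (by linarith), Real.zero_rpow (by linarith)]
    simpa using Real.rpow_pos_of_pos (abs_pos.2 hst) p
  · have htp : 0 < t ^ p := Real.rpow_pos_of_pos ht p
    have ht1 : t ^ (p - 1) = t ^ p / t := by rw [Real.rpow_sub ht, Real.rpow_one]
    have e : t ^ p + p * t ^ (p - 1) * (s - t) = t ^ p * (1 + p * ((s - t) / t)) := by
      rw [ht1]; field_simp
    rw [e]
    rcases le_total 0 s with hs | hs
    · have h1 : -1 ≤ (s - t) / t := by rw [le_div_iff₀ ht]; linarith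
      have h2 : (s - t) / t ≠ 0 := div_ne_zero (sub_ne_zero.2 hst) ht.ne'
      have h3 := one_add_mul_self_lt_rpow_one_add h1 h2 hp
      have h4 : 1 + (s - t) / t = s / t := by field_simp; ring
      rw [h4, Real.div_rpow hs ht.le, lt_div_iff₀ htp] at h3
      rw [abs_of_nonneg hs]
      linarith
    · have h1 : (s - t) / t ≤ -1 := by rw [div_le_iff₀ ht]; linarith
      have h2 : 1 + p * ((s - t) / t) < 0 := by nlinarith
      exact (mul_neg_of_pos_of_neg htp h2).trans_le (Real.rpow_nonneg (abs_nonneg s) p)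

lemma rpow_tangent_le {p : ℝ} (hp : 1 < p) {s t : ℝ} (ht : 0 ≤ t) :
    t ^ p + p * t ^ (p - 1) * (s - t) ≤ |s| ^ p := by
  by_cases h : s = t
  · rw [h, sub_self, mul_zero, add_zero, abs_of_nonneg ht]
  · exact (rpow_tangent_lt hp ht h).le

lemma conjExponent_sub_one {p : ℝ} (hp : 1 < p) : conjExponent p - 1 = (p - 1)⁻¹ := by
  have : p - 1 ≠ 0 := by linarith
  rw [conjExponent]; field_simp; ring

lemma conjExponent_sub_one_mul {p : ℝ} (hp : 1 < p) :
    (conjExponent p - 1) * p = conjExponent p := by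
  rw [conjExponent_sub_one hp, conjExponent]; field_simp

/-- The normalization of the maximizer of `q ↦ ∫ q ρ` over the ball. -/
def dualConst (p r : ℝ) (ρ : ℝ → ℝ) : ℝ :=
  r / (∫ x, ρ x ^ conjExponent p ∂unitMeasure) ^ p⁻¹

/-- The maximizer of `q ↦ ∫ q ρ` over the ball. -/
def dualPotential (p r : ℝ) (ρ : ℝ → ℝ) (x : ℝ) : ℝ :=
  dualConst p r ρ * ρ x ^ (conjExponent p - 1)

section Dual

variable {p r : ℝ} {ρ : ℝ → ℝ}

lemma conjExponent_pos (hp : 1 < p) : 0 < conjExponent p :=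
  div_pos (by linarith) (by linarith)

lemma conjExponent_sub_one_pos (hp : 1 < p) : 0 < conjExponent p - 1 := by
  rw [conjExponent_sub_one hp]; exact inv_pos.2 (by linarith)

lemma continuous_dualPotential (hp : 1 < p) (hρ : Continuous ρ) :
    Continuous (dualPotential p r ρ) :=
  continuous_const.mul (hρ.rpow_const fun _ => Or.inr (conjExponent_sub_one_pos hp).le)

lemma integral_rpow_conjExponent_pos (hp : 1 < p) (hρ : Continuous ρ) (hρ0 : ∀ x, 0 ≤ ρ x)
    (hpos : 0 < ∫ x, ρ x ∂unitMeasure) : 0 < ∫ x, ρ x ^ conjExponent p ∂unitMeasure := by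
  have hnn : ∀ x, 0 ≤ ρ x ^ conjExponent p := fun x => Real.rpow_nonneg (hρ0 x) _
  refine lt_of_le_of_ne (integral_nonneg hnn) fun h => hpos.ne ?_
  have hi : Integrable (fun x => ρ x ^ conjExponent p) unitMeasure :=
    integrable_unit_of_continuous (hρ.rpow_const fun _ => Or.inr (conjExponent_pos hp).le)
  have h1 := (integral_eq_zero_iff_of_nonneg hnn hi).1 h.symm
  rw [integral_congr_ae (g := fun _ => 0)]
  · simp
  · filter_upwards [h1] with x hx
    exact ((Real.rpow_eq_zero (hρ0 x) (conjExponent_pos hp).ne').1 hx)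

lemma dualConst_pos (hp : 1 < p) (hr : 0 < r) (hρ : Continuous ρ) (hρ0 : ∀ x, 0 ≤ ρ x)
    (hpos : 0 < ∫ x, ρ x ∂unitMeasure) : 0 < dualConst p r ρ :=
  div_pos hr (Real.rpow_pos_of_pos (integral_rpow_conjExponent_pos hp hρ hρ0 hpos) _)

lemma dualPotential_nonneg (hp : 1 < p) (hr : 0 < r) (hρ : Continuous ρ) (hρ0 : ∀ x, 0 ≤ ρ x)
    (hpos : 0 < ∫ x, ρ x ∂unitMeasure) (x : ℝ) : 0 ≤ dualPotential p r ρ x :=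
  mul_nonneg (dualConst_pos hp hr hρ hρ0 hpos).le (Real.rpow_nonneg (hρ0 x) _)

lemma integral_dualPotential_rpow (hp : 1 < p) (hr : 0 < r) (hρ : Continuous ρ)
    (hρ0 : ∀ x, 0 ≤ ρ x) (hpos : 0 < ∫ x, ρ x ∂unitMeasure) :
    ∫ x, dualPotential p r ρ x ^ p ∂unitMeasure = r ^ p := by
  have hI := integral_rpow_conjExponent_pos hp hρ hρ0 hpos
  have e : ∀ x, dualPotential p r ρ x ^ p = dualConst p r ρ ^ p * ρ x ^ conjExponent p :=
    fun x => by
      rw [dualPotential, Real.mul_rpow (dualConst_pos hp hr hρ hρ0 hpos).le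
        (Real.rpow_nonneg (hρ0 x) _), ← Real.rpow_mul (hρ0 x), conjExponent_sub_one_mul hp]
  simp only [e]
  rw [integral_const_mul, dualConst, Real.div_rpow hr.le (Real.rpow_nonneg hI.le _),
    ← Real.rpow_mul hI.le, inv_mul_cancel₀ (by linarith), Real.rpow_one, div_mul_cancel₀ _ hI.ne']

lemma dualPotential_mem (hp : 1 < p) (hr : 0 < r) (hρ : Continuous ρ) (hρ0 : ∀ x, 0 ≤ ρ x)
    (hpos : 0 < ∫ x, ρ x ∂unitMeasure) : dualPotential p r ρ ∈ potentialBall p r := by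
  have hc := continuous_dualPotential (r := r) hp hρ
  have hnn := dualPotential_nonneg hp hr hρ hρ0 hpos
  refine ⟨hc.aestronglyMeasurable, integrable_unit_of_continuous
    (hc.abs.rpow_const fun _ => Or.inr (by linarith)), ?_⟩
  simp only [abs_of_nonneg (hnn _)]
  exact (integral_dualPotential_rpow hp hr hρ hρ0 hpos).le

/-- The equality case of Hölder's inequality, in tangent form. -/
lemma integral_dual_le (hp : 1 < p) (hr : 0 < r) (hρ : Continuous ρ) (hρ0 : ∀ x, 0 ≤ ρ x)
    (hpos : 0 < ∫ x, ρ x ∂unitMeasure) {q : ℝ → ℝ} (hq : q ∈ potentialBall p r) :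
    ∫ x, (q x - dualPotential p r ρ x) * ρ x ∂unitMeasure ≤ 0 ∧
      (0 ≤ ∫ x, (q x - dualPotential p r ρ x) * ρ x ∂unitMeasure →
        q =ᵐ[unitMeasure] dualPotential p r ρ) := by
  set s := dualPotential p r ρ with hs
  have hc : Continuous s := continuous_dualPotential hp hρ
  have hnn : ∀ x, 0 ≤ s x := dualPotential_nonneg hp hr hρ hρ0 hpos
  set c := dualConst p r ρ
  have hcpos : 0 < c := dualConst_pos hp hr hρ hρ0 hpos
  have hqi := potentialBall_integrable hp.le hq
  have hsi := integrable_unit_of_continuous hc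
  have hpow : ∀ x, s x ^ (p - 1) = c ^ (p - 1) * ρ x := fun x => by
    rw [hs, dualPotential, Real.mul_rpow hcpos.le (Real.rpow_nonneg (hρ0 x) _),
      ← Real.rpow_mul (hρ0 x), conjExponent_sub_one hp, inv_mul_cancel₀ (by linarith),
      Real.rpow_one]
  have hi1 : Integrable (fun x => s x ^ p) unitMeasure :=
    integrable_unit_of_continuous (hc.rpow_const fun _ => Or.inr (by linarith))
  have hi2 : Integrable (fun x => (q x - s x) * ρ x) unitMeasure :=
    integrable_mul_continuous (hqi.sub hsi) hρ
  -- The tangent slope of |·|^p at s(x) is A ρ(x). Since ∫ s^p = r^p, integrating the tangent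
  -- inequality gives A ∫ (q - s) ρ ≤ ∫ |q|^p - r^p ≤ 0. If the pairing is also nonnegative, the
  -- pointwise defect d vanishes almost everywhere, and strictness of the tangent inequality gives q
  -- = s.
  set A := p * c ^ (p - 1) with hA
  have hApos : 0 < A := mul_pos (by linarith) (Real.rpow_pos_of_pos hcpos _)
  set d : ℝ → ℝ := fun x => |q x| ^ p - (s x ^ p + A * ((q x - s x) * ρ x)) with hd
  have hde : ∀ x, s x ^ p + A * ((q x - s x) * ρ x)
      = s x ^ p + p * s x ^ (p - 1) * (q x - s x) := fun x => by rw [hpow, hA]; ring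
  have hd0 : ∀ x, 0 ≤ d x := fun x => by
    rw [hd]; dsimp only; rw [hde, sub_nonneg]; exact rpow_tangent_le hp (hnn x)
  have hdi : Integrable d unitMeasure := hq.2.1.sub (hi1.add (hi2.const_mul A))
  have hint : ∫ x, d x ∂unitMeasure = ∫ x, |q x| ^ p ∂unitMeasure
      - (r ^ p + A * ∫ x, (q x - s x) * ρ x ∂unitMeasure) := by
    have h1 : ∫ x, s x ^ p ∂unitMeasure = r ^ p := integral_dualPotential_rpow hp hr hρ hρ0 hpos
    have h2 : ∫ x, (s x ^ p + A * ((q x - s x) * ρ x)) ∂unitMeasure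
        = r ^ p + A * ∫ x, (q x - s x) * ρ x ∂unitMeasure := by
      rw [integral_add hi1 (hi2.const_mul A), integral_const_mul, h1]
    rw [← h2]
    exact integral_sub hq.2.1 (hi1.add (hi2.const_mul A))
  have hnn2 : 0 ≤ ∫ x, d x ∂unitMeasure := integral_nonneg hd0
  have hq3 := hq.2.2
  refine ⟨?_, fun h => ?_⟩
  · by_contra! h
    have := mul_pos hApos h
    linarith
  · have h0 : ∫ x, d x ∂unitMeasure = 0 := by
      have := mul_nonneg hApos.le h
      exact le_antisymm (by linarith) hnn2
    filter_upwards [(integral_eq_zero_iff_of_nonneg hd0 hdi).1 h0] with x hx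
    by_contra hne
    have h1 := rpow_tangent_lt hp (hnn x) hne
    rw [← hde, ← sub_pos] at h1
    exact h1.ne' hx

end Dual

/-- For m > 0 this keeps the density from vanishing, so that its dual potential is properly
normalized. -/
lemma integral_density {q : ℝ → ℝ} (hq : Integrable q unitMeasure) (m : ℕ) :
    ∫ x, density hq m x ∂unitMeasure = m := by
  have := integral_mul_density hq m (integrable_const 1)
  simp only [one_mul] at this
  rw [this]
  have h : ∀ i : ℕ, potentialForm (q := fun _ => 1) (integrable_const 1) (eigenvector hq i)
      (eigenvector hq i) = 1 := fun i => massForm_eigenvector_self hq i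
  simp [h]

/-! ### Minimizers -/

/-- The sum of the eigenvalues attains its minimum over the ball. -/
lemma exists_minimizer {p r : ℝ} (hp : 1 < p) (hr : 0 < r) {m : ℕ} (hm : 0 < m) :
    ∃ q ∈ potentialBall p r, ∀ q' ∈ potentialBall p r, eigenvalueSum m q ≤ eigenvalueSum m q' := by
  set R := 1 + r ^ p with hR
  have hRpos : 0 < R := by positivity
  set A := eigenvalueSum m '' potentialBall p r with hA
  have h0 : (fun _ => 0) ∈ potentialBall p r := by
    refine ⟨aestronglyMeasurable_const, ?_, ?_⟩ <;>
      simp [Real.zero_rpow (show p ≠ 0 by linarith), Real.rpow_nonneg hr.le]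
  have hAne : A.Nonempty := ⟨_, _, h0, rfl⟩
  have hAb : BddBelow A := by
    refine ⟨∑ i ∈ Finset.range m, -(2 * R ^ 2), ?_⟩
    rintro _ ⟨q, hq, rfl⟩
    exact Finset.sum_le_sum fun i _ => dirichletEigenvalue_ge (potentialBall_integrable hp.le hq)
      hRpos (potentialBall_integral_abs_le hp.le hq) i
  have hseq : ∀ k : ℕ, ∃ q ∈ potentialBall p r,
      eigenvalueSum m q < sInf A + 1 / ((k : ℝ) + 1) := fun k => by
    obtain ⟨_, ⟨q, hq, rfl⟩, h⟩ := exists_lt_of_csInf_lt hAne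
      (lt_add_of_pos_right (sInf A) (Nat.one_div_pos_of_nat (α := ℝ) (n := k)))
    exact ⟨q, hq, h⟩
  choose q hqB hq using hseq
  have hqi := fun k => potentialBall_integrable hp.le (hqB k)
  have hqR := fun k => potentialBall_integral_abs_le hp.le (hqB k)
  obtain ⟨ν, w, -, -, hu, -, horth⟩ := exists_eigenvector_limit (hyperfilter ℕ) m hRpos hqi hqR
  have hden := tendstoUniformlyOn_density hqi hu
  set ρ : ℝ → ℝ := fun x => ∑ i, primitive (w i) x ^ 2 with hρ
  have hρc : Continuous ρ :=
    continuous_finsetSum _ fun _ _ => (continuous_primitive (L2Unit.integrable _)).pow 2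
  have hρ0 : ∀ x, 0 ≤ ρ x := fun x => Finset.sum_nonneg fun _ _ => sq_nonneg _
  have hρpos : 0 < ∫ x, ρ x ∂unitMeasure := by
    have : ∫ x, ρ x ∂unitMeasure = m := by
      have h1 : ∫ x, ρ x ∂unitMeasure = ∑ i, ∫ x, primitive (w i) x ^ 2 ∂unitMeasure :=
        integral_finsetSum _ fun i _ => integrable_unit_of_continuous
          ((continuous_primitive (L2Unit.integrable _)).pow 2)
      rw [h1]
      simp only [← massForm_self, horth, if_true]
      simp
    rw [this]; exact_mod_cast hm
  set Q : ℝ → ℝ := fun x => -dualPotential p r ρ x with hQ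
  have hQB : Q ∈ potentialBall p r := neg_mem_potentialBall (dualPotential_mem hp hr hρc hρ0 hρpos)
  have hQi := potentialBall_integrable hp.le hQB
  refine ⟨Q, hQB, fun q' hq' => le_trans ?_ (csInf_le hAb ⟨q', hq', rfl⟩)⟩
  -- E(Q) ≤ E(q k) + ∫ (Q - q k) ρₖ with ρₖ the density of `q k`. Replacing ρₖ by ρ costs an error
  -- tending to 0, and ∫ (Q - q k) ρ ≤ 0 because Q minimizes the pairing with ρ over the ball.
  have h1 : Tendsto (fun k : ℕ => sInf A + 1 / ((k : ℝ) + 1)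
      + (∫ x, (Q x - q k x) * density (hqi k) m x ∂unitMeasure
        - ∫ x, (Q x - q k x) * ρ x ∂unitMeasure)) (hyperfilter ℕ) (𝓝 (sInf A + 0 + 0)) := by
    refine Tendsto.add ?_ ?_
    · exact (tendsto_const_nhds.add
        (tendsto_one_div_add_atTop_nhds_zero_nat (𝕜 := ℝ))).mono_left Nat.hyperfilter_le_atTop
    · refine tendsto_integral_mul_sub (R := R + R) (fun k => hQi.sub (hqi k)) (fun k => ?_)
        (fun k => continuous_density (hqi k) m) hρc hden
      have hQR := potentialBall_integral_abs_le hp.le hQB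
      refine (integral_mono (hQi.sub (hqi k)).abs (hQi.abs.add (hqi k).abs)
        fun x => abs_sub _ _).trans ?_
      simp only [Pi.add_apply]
      rw [integral_add hQi.abs (hqi k).abs]
      exact add_le_add hQR (hqR k)
  rw [add_zero, add_zero] at h1
  refine ge_of_tendsto h1 (Eventually.of_forall fun k => ?_)
  have h2 := eigenvalueSum_le_add hQi (hqi k) m
  have h3 : ∫ x, (Q x - q k x) * ρ x ∂unitMeasure ≤ 0 := by
    have := (integral_dual_le hp hr hρc hρ0 hρpos (neg_mem_potentialBall (hqB k))).1
    refine le_of_eq_of_le ?_ this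
    congr 1; ext x; rw [hQ]; ring
  linarith [hq k]

/-- A minimizer is determined by its density. -/
lemma minimizer_eq_dualPotential {p r : ℝ} (hp : 1 < p) (hr : 0 < r) {m : ℕ} (hm : 0 < m)
    {q : ℝ → ℝ} (hq : q ∈ potentialBall p r) (hqi : Integrable q unitMeasure)
    (hmin : ∀ q' ∈ potentialBall p r, eigenvalueSum m q ≤ eigenvalueSum m q') :
    q =ᵐ[unitMeasure] fun x => -dualPotential p r (density hqi m) x := by
  have hρ := continuous_density hqi m
  have hρ0 := density_nonneg hqi m
  have hpos : 0 < ∫ x, density hqi m x ∂unitMeasure := by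
    rw [integral_density]; exact_mod_cast hm
  have hd := neg_mem_potentialBall (dualPotential_mem hp hr hρ hρ0 hpos)
  -- Minimality and the supergradient inequality give ∫ (-d - q) ρ ≥ 0, with d the dual potential of
  -- ρ. This is the equality case of Hölder's inequality for -q.
  have h1 := (hmin _ hd).trans (eigenvalueSum_le_add (potentialBall_integrable hp.le hd) hqi m)
  have h2 := (integral_dual_le hp hr hρ hρ0 hpos (neg_mem_potentialBall hq)).2 (by
    have : ∫ x, (-q x - dualPotential p r (density hqi m) x) * density hqi m x ∂unitMeasure
        = ∫ x, (-dualPotential p r (density hqi m) x - q x) * density hqi m x ∂unitMeasure := by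
      congr 1; ext x; ring
    rw [this]; linarith)
  filter_upwards [h2] with x hx
  linarith

/-! ### First-order condition for maximizers -/

lemma add_smul_sub_mem_potentialBall {p r : ℝ} (hp : 1 < p) {f g : ℝ → ℝ}
    (hf : f ∈ potentialBall p r) (hg : g ∈ potentialBall p r) {t : ℝ} (ht : t ∈ Icc (0 : ℝ) 1) :
    (fun x => f x + t * (g x - f x)) ∈ potentialBall p r := by
  have hb : ∀ x, |f x + t * (g x - f x)| ^ p ≤ (1 - t) * |f x| ^ p + t * |g x| ^ p := fun x => by
    have h1 : |f x + t * (g x - f x)| ≤ (1 - t) * |f x| + t * |g x| := by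
      have : f x + t * (g x - f x) = (1 - t) * f x + t * g x := by ring
      rw [this]
      refine (abs_add_le _ _).trans_eq ?_
      rw [abs_mul, abs_mul, abs_of_nonneg ht.1, abs_of_nonneg (sub_nonneg.2 ht.2)]
    refine (Real.rpow_le_rpow (abs_nonneg _) h1 (by linarith)).trans ?_
    exact (convexOn_rpow hp.le).2 (abs_nonneg (f x)) (abs_nonneg (g x)) (sub_nonneg.2 ht.2) ht.1
      (by ring)
  have hm : AEStronglyMeasurable (fun x => f x + t * (g x - f x)) unitMeasure :=
    hf.1.add ((hg.1.sub hf.1).const_mul t)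
  have hi : Integrable (fun x => (1 - t) * |f x| ^ p + t * |g x| ^ p) unitMeasure :=
    (hf.2.1.const_mul _).add (hg.2.1.const_mul _)
  have hi2 : Integrable (fun x => |f x + t * (g x - f x)| ^ p) unitMeasure := by
    refine hi.mono' ?_ (Eventually.of_forall fun x => ?_)
    · exact (hm.norm.aemeasurable.pow_const p).aestronglyMeasurable
    · rw [Real.norm_of_nonneg (Real.rpow_nonneg (abs_nonneg _) _)]; exact hb x
  refine ⟨hm, hi2, (integral_mono hi2 hi hb).trans ?_⟩
  rw [integral_add (hf.2.1.const_mul _) (hg.2.1.const_mul _), integral_const_mul,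
    integral_const_mul]
  nlinarith [hf.2.2, hg.2.2, ht.1, ht.2]

/-- A maximizer is determined by its density. -/
lemma maximizer_eq_dualPotential {p r : ℝ} (hp : 1 < p) (hr : 0 < r) {m : ℕ} (hm : 0 < m)
    {q : ℝ → ℝ} (hq : q ∈ potentialBall p r) (hqi : Integrable q unitMeasure)
    (hmax : ∀ q' ∈ potentialBall p r, eigenvalueSum m q' ≤ eigenvalueSum m q) :
    q =ᵐ[unitMeasure] dualPotential p r (density hqi m) := by
  have hρ := continuous_density hqi m
  have hρ0 := density_nonneg hqi m
  have hpos : 0 < ∫ x, density hqi m x ∂unitMeasure := by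
    rw [integral_density]; exact_mod_cast hm
  set d := dualPotential p r (density hqi m) with hd
  have hdB : d ∈ potentialBall p r := dualPotential_mem hp hr hρ hρ0 hpos
  have hdi := potentialBall_integrable hp.le hdB
  refine (integral_dual_le hp hr hρ hρ0 hpos hq).2 ?_
  -- The supergradient inequality must be used at q + t (d - q), not at q, to bound E(q) from above.
  -- Maximality of q then gives ∫ (q - d) ρₜ ≥ 0 for every t > 0, and continuity of the density
  -- yields the same at t = 0.
  set t : ℕ → ℝ := fun k => 1 / ((k : ℝ) + 1) with ht
  have htpos : ∀ k, 0 < t k := fun k => Nat.one_div_pos_of_nat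
  have ht1 : ∀ k, t k ≤ 1 := fun k => by
    rw [ht]; dsimp only
    rw [div_le_one (by positivity)]
    linarith [(Nat.cast_nonneg k : (0 : ℝ) ≤ k)]
  set qt : ℕ → ℝ → ℝ := fun k x => q x + t k * (d x - q x) with hqt
  have hqtB : ∀ k, qt k ∈ potentialBall p r := fun k =>
    add_smul_sub_mem_potentialBall hp hq hdB ⟨(htpos k).le, ht1 k⟩
  have hqti := fun k => potentialBall_integrable hp.le (hqtB k)
  have hlim : Tendsto (fun k => ∫ x, |qt k x - q x| ∂unitMeasure) (hyperfilter ℕ) (𝓝 0) := by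
    have e : ∀ k, ∫ x, |qt k x - q x| ∂unitMeasure = t k * ∫ x, |d x - q x| ∂unitMeasure :=
      fun k => by
        rw [← integral_const_mul]
        congr 1; ext x
        rw [hqt]; dsimp only
        rw [add_sub_cancel_left, abs_mul, abs_of_pos (htpos k)]
    simp only [e]
    simpa [ht] using ((tendsto_one_div_add_atTop_nhds_zero_nat (𝕜 := ℝ)).mul_const
      (∫ x, |d x - q x| ∂unitMeasure)).mono_left Nat.hyperfilter_le_atTop
  have hden := tendstoUniformlyOn_density_of_tendsto (hyperfilter ℕ) m (R := 1 + r ^ p)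
    (by positivity) hqti (fun k => potentialBall_integral_abs_le hp.le (hqtB k)) hqi hlim
  have h1 := tendsto_integral_mul (hqi.sub hdi) (fun k => continuous_density (hqti k) m) hρ hden
  refine ge_of_tendsto h1 (Eventually.of_forall fun k => ?_)
  have h2 := (eigenvalueSum_le_add hqi (hqti k) m).trans
    (add_le_add_left (hmax _ (hqtB k)) _)
  have h3 : ∫ x, (q x - qt k x) * density (hqti k) m x ∂unitMeasure
      = t k * ∫ x, (q x - d x) * density (hqti k) m x ∂unitMeasure := by
    rw [← integral_const_mul]
    congr 1; ext x
    simp only [hqt]; ring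
  rw [h3] at h2
  have h4 : 0 ≤ t k * ∫ x, (q x - d x) * density (hqti k) m x ∂unitMeasure := by linarith
  exact nonneg_of_mul_nonneg_right h4 (htpos k)

/-! ### Weak compactness of the ball -/

/-- Uniform integrability of the ball. -/
lemma exists_setIntegral_abs_le {p r : ℝ} (hp : 1 < p) {ε : ℝ} (hε : 0 < ε) :
    ∃ N : ℝ, 0 ≤ N ∧ ∀ q ∈ potentialBall p r, ∀ A : Set ℝ,
      |∫ x in A, q x ∂unitMeasure| ≤ N * unitMeasure.real A + ε := by
  have hlim : Tendsto (fun N : ℝ => N ^ (-(p - 1)) * r ^ p) atTop (𝓝 (0 * r ^ p)) :=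
    (tendsto_rpow_neg_atTop (sub_pos.2 hp)).mul_const _
  rw [zero_mul] at hlim
  obtain ⟨N, hNε, hN⟩ := ((hlim.eventually (ge_mem_nhds hε)).and (eventually_gt_atTop 0)).exists
  refine ⟨N, hN.le, fun q hq A => ?_⟩
  -- Rescale |s| ≤ 1 + |s|^p by N. The second coefficient tends to 0 as N grows, because p > 1.
  have hpt : ∀ s : ℝ, |s| ≤ N + N ^ (-(p - 1)) * |s| ^ p := fun s => by
    have h := abs_le_one_add_rpow hp.le (s / N)
    rw [abs_div, abs_of_pos hN, Real.div_rpow (abs_nonneg s) hN.le, div_le_iff₀ hN] at h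
    refine h.trans_eq ?_
    rw [neg_sub, Real.rpow_sub hN, Real.rpow_one]
    field_simp
  have hi : Integrable (fun x => N + N ^ (-(p - 1)) * |q x| ^ p) unitMeasure :=
    (integrable_const N).add (hq.2.1.const_mul _)
  have h1 : |∫ x in A, q x ∂unitMeasure| ≤
      ∫ x in A, (N + N ^ (-(p - 1)) * |q x| ^ p) ∂unitMeasure :=
    norm_integral_le_of_norm_le (f := q) hi.restrict (Eventually.of_forall fun x => hpt (q x))
  refine h1.trans ?_
  rw [integral_add (integrable_const N) (hq.2.1.const_mul _).restrict, integral_const_mul,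
    setIntegral_const, smul_eq_mul, mul_comm]
  refine add_le_add le_rfl (le_trans ?_ hNε)
  refine mul_le_mul_of_nonneg_left ?_ (Real.rpow_nonneg hN.le _)
  exact (setIntegral_le_integral hq.2.1 (Eventually.of_forall fun x =>
    Real.rpow_nonneg (abs_nonneg _) _)).trans hq.2.2

/-- Along an ultrafilter, the integrals of functions in the ball over measurable sets converge to
those of an integrable function. -/
lemma exists_setIntegral_limit {ι : Type*} (U : Ultrafilter ι) {p r : ℝ} (hp : 1 < p)
    {q : ι → ℝ → ℝ} (hq : ∀ k, q k ∈ potentialBall p r) :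
    ∃ q₀ : ℝ → ℝ, Measurable q₀ ∧ Integrable q₀ unitMeasure ∧ ∀ A, MeasurableSet A →
      Tendsto (fun k => ∫ x in A, q k x ∂unitMeasure) U (𝓝 (∫ x in A, q₀ x ∂unitMeasure)) := by
  have hqi := fun k => potentialBall_integrable hp.le (hq k)
  have hbd : ∀ (A : Set ℝ) k, |∫ x in A, q k x ∂unitMeasure| ≤ 1 + r ^ p := fun A k => by
    refine (norm_integral_le_integral_norm (μ := unitMeasure.restrict A) (q k)).trans ?_
    refine (setIntegral_le_integral (hqi k).norm
      (Eventually.of_forall fun x => norm_nonneg _)).trans ?_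
    exact potentialBall_integral_abs_le hp.le (hq k)
  choose L hL using fun A : Set ℝ => exists_tendsto_of_abs_le U (hbd A)
  have hLle : ∀ ε > 0, ∃ N : ℝ, 0 ≤ N ∧ ∀ A : Set ℝ, |L A| ≤ N * unitMeasure.real A + ε :=
    fun ε hε => by
      obtain ⟨N, hN, h⟩ := exists_setIntegral_abs_le (r := r) hp hε
      exact ⟨N, hN, fun A => le_of_tendsto (hL A).abs (Eventually.of_forall fun k => h _ (hq k) A)⟩
  have hLunion : ∀ A B : Set ℝ, Disjoint A B → MeasurableSet B → L (A ∪ B) = L A + L B :=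
    fun A B hAB hB => by
      refine tendsto_nhds_unique (hL (A ∪ B)) (((hL A).add (hL B)).congr fun k => ?_)
      exact (setIntegral_union hAB hB (hqi k).integrableOn (hqi k).integrableOn).symm
  have hLnull : ∀ A : Set ℝ, unitMeasure A = 0 → L A = 0 := fun A hA => by
    refine tendsto_nhds_unique (hL A) (tendsto_const_nhds.congr fun k => ?_)
    rw [setIntegral_measure_zero _ hA]
  have hLsum : ∀ (f : ℕ → Set ℝ) (_ : ∀ i, MeasurableSet (f i))
      (_ : Pairwise (Function.onFun Disjoint f)) (s : Finset ℕ),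
      L (⋃ i ∈ s, f i) = ∑ i ∈ s, L (f i) := fun f hf hd s => by
    induction s using Finset.induction_on with
    | empty => simpa using hLnull ∅ (by simp)
    | insert a s ha ih =>
      rw [Finset.sum_insert ha, Finset.set_biUnion_insert, ← ih]
      refine hLunion _ _ ?_ (s.measurableSet_biUnion fun i _ => hf i)
      rw [disjoint_iUnion₂_right]
      exact fun i hi => hd fun h => ha (h ▸ hi)
  classical
  -- The setwise limit L is finitely additive. Uniform integrability makes L small on the tails of a
  -- disjoint union, which gives countable additivity; the Radon–Nikodym derivative of ν is the
  -- limit potential.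
  let ν : SignedMeasure ℝ :=
    { measureOf' := fun A => if MeasurableSet A then L A else 0
      empty' := by simpa using hLnull ∅ (by simp)
      not_measurable' := fun A hA => if_neg hA
      m_iUnion' := fun f hf hd => by
        simp only [hf, MeasurableSet.iUnion hf, if_true]
        have hμ := hasSum_integral_iUnion (μ := unitMeasure) (f := fun _ => (1 : ℝ)) hf hd
          (integrable_const _)
        simp only [setIntegral_const, smul_eq_mul, mul_one] at hμ
        rw [HasSum, Metric.tendsto_nhds]
        intro ε hε
        obtain ⟨N, hN, hLN⟩ := hLle (ε / 2) (by positivity)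
        have hev := (Metric.tendsto_nhds.1 hμ) (ε / (2 * (N + 1))) (by positivity)
        filter_upwards [hev] with s hs
        have hms : MeasurableSet (⋃ i ∈ s, f i) := s.measurableSet_biUnion fun i _ => hf i
        have hsub : (⋃ i ∈ s, f i) ⊆ ⋃ i, f i := iUnion₂_subset fun i _ => subset_iUnion f i
        have h1 := hLunion ((⋃ i, f i) \ ⋃ i ∈ s, f i) _ disjoint_sdiff_left hms
        rw [sdiff_union_of_subset hsub, hLsum f hf hd s] at h1
        have h2 : unitMeasure.real ((⋃ i, f i) \ ⋃ i ∈ s, f i) =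
            unitMeasure.real (⋃ i, f i) - ∑ i ∈ s, unitMeasure.real (f i) := by
          rw [measureReal_sdiff hsub hms, measureReal_biUnion_finset
            (fun i _ j _ hij => hd hij) (fun i _ => hf i)]
        have h3 := hLN ((⋃ i, f i) \ ⋃ i ∈ s, f i)
        rw [h2] at h3
        rw [Real.dist_eq, abs_sub_comm] at hs ⊢
        have h4 : L (⋃ i, f i) - ∑ i ∈ s, L (f i) = L ((⋃ i, f i) \ ⋃ i ∈ s, f i) := by linarith
        rw [h4]
        have h5 := (le_abs_self _).trans hs.le
        have h6 : N * (unitMeasure.real (⋃ i, f i) - ∑ i ∈ s, unitMeasure.real (f i))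
            ≤ N * (ε / (2 * (N + 1))) := mul_le_mul_of_nonneg_left h5 hN
        have h7 : N * (ε / (2 * (N + 1))) < ε / 2 := by
          rw [← mul_div_assoc, div_lt_div_iff₀ (by positivity) (by norm_num)]
          nlinarith
        linarith }
  have hνapp : ∀ A, MeasurableSet A → ν A = L A := fun A hA => if_pos hA
  have hac : ν ≪ᵥ unitMeasure.toENNRealVectorMeasure := by
    refine VectorMeasure.AbsolutelyContinuous.mk fun A hA hA0 => ?_
    rw [Measure.toENNRealVectorMeasure_apply_measurable hA] at hA0
    rw [hνapp A hA, hLnull A hA0]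
  have hint := SignedMeasure.integrable_rnDeriv ν unitMeasure
  refine ⟨ν.rnDeriv unitMeasure, SignedMeasure.measurable_rnDeriv _ _, hint, fun A hA => ?_⟩
  rw [← withDensityᵥ_apply hint hA, SignedMeasure.withDensityᵥ_rnDeriv_eq _ _ hac, hνapp A hA]
  exact hL A

/-- Round values down to multiples of ε; boundedness leaves finitely many of them. -/
lemma exists_simpleFunc_abs_sub_le {f : ℝ → ℝ} (hf : Measurable f) {M : ℝ} (hM : ∀ x, |f x| ≤ M)
    {ε : ℝ} (hε : 0 < ε) : ∃ s : SimpleFunc ℝ ℝ, ∀ x, |f x - s x| ≤ ε := by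
  have hg : Measurable fun x => ε * (⌊f x / ε⌋ : ℝ) :=
    (measurable_from_top.comp (Int.measurable_floor.comp (hf.div_const ε))).const_mul ε
  refine ⟨⟨fun x => ε * (⌊f x / ε⌋ : ℝ), fun y => hg (measurableSet_singleton y), ?_⟩, fun x => ?_⟩
  · refine ((Set.finite_Icc ⌊-M / ε⌋ ⌊M / ε⌋).image fun n : ℤ => ε * (n : ℝ)).subset ?_
    rintro _ ⟨x, rfl⟩
    refine ⟨⌊f x / ε⌋, ⟨Int.floor_le_floor ?_, Int.floor_le_floor ?_⟩, rfl⟩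
    · have := (abs_le.1 (hM x)).1
      gcongr
    · have := (abs_le.1 (hM x)).2
      gcongr
  · change |f x - ε * (⌊f x / ε⌋ : ℝ)| ≤ ε
    have h1 := Int.floor_le (f x / ε)
    have h2 := (Int.lt_floor_add_one (f x / ε)).le
    rw [le_div_iff₀ hε] at h1
    rw [div_le_iff₀ hε] at h2
    rw [abs_le]
    constructor <;> nlinarith

lemma integrable_mul_bounded {q f : ℝ → ℝ} (hq : Integrable q unitMeasure) (hf : Measurable f)
    {M : ℝ} (hM : ∀ x, |f x| ≤ M) : Integrable (fun x => q x * f x) unitMeasure :=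
  hq.mul_bdd hf.aestronglyMeasurable (Eventually.of_forall hM)

/-- Convergence of integrals over measurable sets implies weak convergence against bounded
measurable functions. -/
lemma tendsto_integral_mul_bounded {ι : Type*} {l : Filter ι} {q : ι → ℝ → ℝ} {q₀ : ℝ → ℝ} {R : ℝ}
    (hq : ∀ k, Integrable (q k) unitMeasure) (hR : ∀ k, ∫ x, |q k x| ∂unitMeasure ≤ R)
    (hq₀ : Integrable q₀ unitMeasure)
    (h : ∀ A, MeasurableSet A →
      Tendsto (fun k => ∫ x in A, q k x ∂unitMeasure) l (𝓝 (∫ x in A, q₀ x ∂unitMeasure)))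
    {f : ℝ → ℝ} (hf : Measurable f) {M : ℝ} (hM : ∀ x, |f x| ≤ M) :
    Tendsto (fun k => ∫ x, q k x * f x ∂unitMeasure) l (𝓝 (∫ x, q₀ x * f x ∂unitMeasure)) := by
  have hsbd : ∀ s : SimpleFunc ℝ ℝ, ∃ B, ∀ x, |s x| ≤ B := fun s => s.exists_forall_norm_le
  have hsi : ∀ {g : ℝ → ℝ}, Integrable g unitMeasure → ∀ s : SimpleFunc ℝ ℝ,
      Integrable (fun x => g x * s x) unitMeasure := fun hg s => by
    obtain ⟨B, hB⟩ := hsbd s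
    exact integrable_mul_bounded hg s.measurable hB
  have hsimple : ∀ s : SimpleFunc ℝ ℝ, Tendsto (fun k => ∫ x, q k x * s x ∂unitMeasure) l
      (𝓝 (∫ x, q₀ x * s x ∂unitMeasure)) := fun s => by
    induction s using SimpleFunc.induction with
    | @const c A hA =>
      have e : ∀ g : ℝ → ℝ, ∫ x, g x * (SimpleFunc.piecewise A hA (SimpleFunc.const ℝ c)
          (SimpleFunc.const ℝ 0)) x ∂unitMeasure = (∫ x in A, g x ∂unitMeasure) * c := fun g => by
        rw [← integral_mul_const, ← integral_indicator hA]
        congr 1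
        ext x
        by_cases hx : x ∈ A <;> simp [hx]
      simp only [e]
      exact (h A hA).mul_const c
    | @add s t _ hs ht =>
      simp only [SimpleFunc.coe_add, Pi.add_apply, mul_add]
      rw [integral_add (hsi hq₀ s) (hsi hq₀ t)]
      refine (hs.add ht).congr fun k => ?_
      rw [integral_add (hsi (hq k) s) (hsi (hq k) t)]
  rw [Metric.tendsto_nhds]
  intro ε hε
  set B := |R| + ∫ x, |q₀ x| ∂unitMeasure + 1 with hB
  have hB0 : 0 ≤ ∫ x, |q₀ x| ∂unitMeasure := integral_nonneg fun x => abs_nonneg _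
  have hBpos : 0 < B := by positivity
  obtain ⟨s, hs⟩ := exists_simpleFunc_abs_sub_le hf hM (ε := ε / (2 * B)) (by positivity)
  have happrox : ∀ {g : ℝ → ℝ}, Integrable g unitMeasure →
      |∫ x, g x * f x ∂unitMeasure - ∫ x, g x * s x ∂unitMeasure| ≤
        (∫ x, |g x| ∂unitMeasure) * (ε / (2 * B)) := fun {g} hg => by
    rw [← integral_sub (integrable_mul_bounded hg hf hM) (hsi hg s)]
    simp only [← mul_sub]
    exact abs_integral_mul_le hg fun x _ => hs x
  filter_upwards [(Metric.tendsto_nhds.1 (hsimple s)) (ε / (2 * B)) (by positivity)] with k hk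
  have h1 := happrox (hq k)
  have h2 := happrox hq₀
  have h3 : (∫ x, |q k x| ∂unitMeasure) * (ε / (2 * B)) ≤ |R| * (ε / (2 * B)) := by
    gcongr
    exact (hR k).trans (le_abs_self R)
  rw [Real.dist_eq] at hk ⊢
  have h4 : |R| * (ε / (2 * B)) + (∫ x, |q₀ x| ∂unitMeasure) * (ε / (2 * B)) + ε / (2 * B)
      = ε / 2 := by
    rw [← add_mul, ← add_one_mul, ← hB]; field_simp
  rw [abs_le] at h1 h2
  rw [abs_lt] at hk ⊢
  constructor <;> linarith [h1.1, h1.2, h2.1, h2.2, hk.1, hk.2]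

/-- The tangent inequality at an arbitrary point. -/
lemma rpow_abs_tangent_le {p : ℝ} (hp : 1 < p) (s t : ℝ) :
    |t| ^ p + p * (SignType.sign t * |t| ^ (p - 1)) * (s - t) ≤ |s| ^ p := by
  rcases lt_trichotomy t 0 with h | h | h
  · have := rpow_tangent_le hp (s := -s) (t := -t) (by linarith)
    rw [abs_neg] at this
    rw [abs_of_neg h, sign_neg h]
    refine le_trans (le_of_eq ?_) this
    simp; ring
  · rw [h, abs_zero, Real.zero_rpow (by linarith)]
    simpa using Real.rpow_nonneg (abs_nonneg s) p
  · have := rpow_tangent_le hp (s := s) h.le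
    rw [abs_of_pos h, sign_pos h]
    simpa using this

/-- The ball is weakly compact. -/
lemma exists_weak_limit_potentialBall {ι : Type*} (U : Ultrafilter ι) {p r : ℝ} (hp : 1 < p)
    {q : ι → ℝ → ℝ} (hq : ∀ k, q k ∈ potentialBall p r) :
    ∃ q₀ ∈ potentialBall p r, ∀ (f : ℝ → ℝ) (M : ℝ), Measurable f → (∀ x, |f x| ≤ M) →
      Tendsto (fun k => ∫ x, q k x * f x ∂unitMeasure) U (𝓝 (∫ x, q₀ x * f x ∂unitMeasure)) := by
  obtain ⟨q₀, hm, hi, hlim⟩ := exists_setIntegral_limit U hp hq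
  have hqi := fun k => potentialBall_integrable hp.le (hq k)
  have hweak : ∀ (f : ℝ → ℝ) (M : ℝ), Measurable f → (∀ x, |f x| ≤ M) →
      Tendsto (fun k => ∫ x, q k x * f x ∂unitMeasure) U (𝓝 (∫ x, q₀ x * f x ∂unitMeasure)) :=
    fun f M hf hM => tendsto_integral_mul_bounded hqi
      (fun k => potentialBall_integral_abs_le hp.le (hq k)) hi hlim hf hM
  have hpm : Measurable fun x => |q₀ x| ^ p := hm.abs.pow_const p
  have hnn : ∀ x, 0 ≤ |q₀ x| ^ p := fun x => Real.rpow_nonneg (abs_nonneg _) _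
  set S : ℕ → Set ℝ := fun N => {x | |q₀ x| ≤ N} with hS
  have hSm : ∀ N, MeasurableSet (S N) := fun N => measurableSet_le hm.abs measurable_const
  have hSi : ∀ N, IntegrableOn (fun x => |q₀ x| ^ p) (S N) unitMeasure := fun N => by
    refine Measure.integrableOn_of_bounded (measure_ne_top _ _) hpm.aestronglyMeasurable
      (M := (N : ℝ) ^ p) ?_
    filter_upwards [ae_restrict_mem (hSm N)] with x hx
    rw [Real.norm_of_nonneg (hnn x)]
    exact Real.rpow_le_rpow (abs_nonneg _) hx (by linarith)
  -- Lower semicontinuity of the norm by convexity: f is the derivative of |·|^p at q₀, cut off to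
  -- be a bounded test function. The tangent inequality bounds the integral over `S N`, up to an
  -- error ∫ (q k - q₀) f that tends to 0, by ∫ |q k|^p.
  have hSle : ∀ N, ∫ x in S N, |q₀ x| ^ p ∂unitMeasure ≤ r ^ p := fun N => by
    set f : ℝ → ℝ := (S N).indicator
      fun x => p * (SignType.sign (q₀ x) * |q₀ x| ^ (p - 1)) with hf
    have hsm : Measurable fun x => ((SignType.sign (q₀ x) : SignType) : ℝ) := by
      have : (fun x => ((SignType.sign (q₀ x) : SignType) : ℝ)) =
          fun x => if 0 < q₀ x then 1 else if q₀ x < 0 then -1 else 0 := by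
        ext x
        rw [sign_apply]
        split_ifs <;> simp
      rw [this]
      exact Measurable.ite (measurableSet_lt measurable_const hm) measurable_const
        (Measurable.ite (measurableSet_lt hm measurable_const) measurable_const measurable_const)
    have hfm : Measurable f :=
      ((hsm.mul (hm.abs.pow_const (p - 1))).const_mul p).indicator (hSm N)
    have hfb : ∀ x, |f x| ≤ p * (N : ℝ) ^ (p - 1) := fun x => by
      by_cases hx : x ∈ S N
      · rw [hf, indicator_of_mem hx, abs_mul, abs_of_pos (by linarith : 0 < p), abs_mul,
          abs_of_nonneg (Real.rpow_nonneg (abs_nonneg (q₀ x)) _)]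
        have h1 : |((SignType.sign (q₀ x) : SignType) : ℝ)| ≤ 1 := by
          rcases SignType.sign (q₀ x) with _ | _ | _ <;> simp
        have h2 : |q₀ x| ^ (p - 1) ≤ (N : ℝ) ^ (p - 1) :=
          Real.rpow_le_rpow (abs_nonneg _) hx (by linarith)
        have h3 := mul_le_mul h1 h2 (Real.rpow_nonneg (abs_nonneg _) _) zero_le_one
        rw [one_mul] at h3
        exact mul_le_mul_of_nonneg_left h3 (by linarith)
      · rw [hf, indicator_of_notMem hx, abs_zero]
        have := Real.rpow_nonneg (Nat.cast_nonneg N : (0 : ℝ) ≤ N) (p - 1)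
        nlinarith
    have h1 := ((hweak f _ hfm hfb).sub_const (∫ x, q₀ x * f x ∂unitMeasure)).add_const
      (∫ x in S N, |q₀ x| ^ p ∂unitMeasure)
    rw [sub_self, zero_add] at h1
    refine le_of_tendsto h1 (Eventually.of_forall fun k => ?_)
    have hki := integrable_mul_bounded (hqi k) hfm hfb
    have h0i := integrable_mul_bounded hi hfm hfb
    have hind : Integrable ((S N).indicator fun x => |q₀ x| ^ p) unitMeasure :=
      (integrable_indicator_iff (hSm N)).2 (hSi N)
    have hadd : ∫ x, (q k x * f x - q₀ x * f x + (S N).indicator (fun x => |q₀ x| ^ p) x)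
        ∂unitMeasure = ∫ x, q k x * f x ∂unitMeasure - ∫ x, q₀ x * f x ∂unitMeasure
          + ∫ x in S N, |q₀ x| ^ p ∂unitMeasure := by
      rw [← integral_indicator (hSm N), ← integral_sub hki h0i]
      exact integral_add (hki.sub h0i) hind
    rw [← hadd]
    refine le_trans (integral_mono ((hki.sub h0i).add hind) (hq k).2.1 fun x => ?_) (hq k).2.2
    dsimp only
    by_cases hx : x ∈ S N
    · rw [hf, indicator_of_mem hx, indicator_of_mem hx]
      have := rpow_abs_tangent_le hp (q k x) (q₀ x)
      linarith
    · rw [hf, indicator_of_notMem hx, indicator_of_notMem hx]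
      simpa using Real.rpow_nonneg (abs_nonneg (q k x)) p
  have hcover : AECover unitMeasure atTop S :=
    ⟨Eventually.of_forall fun x => by
      obtain ⟨N, hN⟩ := exists_nat_ge |q₀ x|
      filter_upwards [eventually_ge_atTop N] with n hn
      exact hN.trans (by exact_mod_cast hn), hSm⟩
  have hI := hcover.integrable_of_integral_bounded_of_nonneg_ae (r ^ p) hSi
    (Eventually.of_forall hnn) (Eventually.of_forall hSle)
  exact ⟨q₀, ⟨hm.aestronglyMeasurable, hI, le_of_tendsto
    (hcover.integral_tendsto_of_countably_generated hI) (Eventually.of_forall hSle)⟩, hweak⟩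

/-! ### Existence of a maximizer -/

/-- The sum of the eigenvalues attains its maximum over the ball. -/
lemma exists_maximizer {p r : ℝ} (hp : 1 < p) (hr : 0 < r) (m : ℕ) :
    ∃ q ∈ potentialBall p r, ∀ q' ∈ potentialBall p r, eigenvalueSum m q' ≤ eigenvalueSum m q := by
  set A := eigenvalueSum m '' potentialBall p r with hA
  have h0 : (fun _ => 0) ∈ potentialBall p r := by
    refine ⟨aestronglyMeasurable_const, ?_, ?_⟩ <;>
      simp [Real.zero_rpow (show p ≠ 0 by linarith), Real.rpow_nonneg hr.le]
  have hAne : A.Nonempty := ⟨_, _, h0, rfl⟩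
  have hAb : BddAbove A := by
    obtain ⟨C, hC⟩ := exists_eigenvalueSum_le m (1 + r ^ p)
    refine ⟨C, ?_⟩
    rintro _ ⟨q, hq, rfl⟩
    exact hC q (potentialBall_integrable hp.le hq) (potentialBall_integral_abs_le hp.le hq)
  have hseq : ∀ k : ℕ, ∃ q ∈ potentialBall p r,
      sSup A - 1 / ((k : ℝ) + 1) < eigenvalueSum m q := fun k => by
    obtain ⟨_, ⟨q, hq, rfl⟩, h⟩ := exists_lt_of_lt_csSup hAne
      (sub_lt_self (sSup A) (Nat.one_div_pos_of_nat (α := ℝ) (n := k)))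
    exact ⟨q, hq, h⟩
  choose q hqB hq using hseq
  obtain ⟨q₀, hq₀, hweak⟩ := exists_weak_limit_potentialBall (hyperfilter ℕ) hp hqB
  have hqi := fun k => potentialBall_integrable hp.le (hqB k)
  have hq₀i := potentialBall_integrable hp.le hq₀
  refine ⟨q₀, hq₀, fun q' hq' => (le_csSup hAb ⟨q', hq', rfl⟩).trans ?_⟩
  have hc := continuous_density hq₀i m
  set B := ∑ i : Fin m, ‖eigenvector hq₀i i‖ ^ 2 with hB
  have hb : ∀ x, |density hq₀i m x| ≤ B := fun x => by
    rw [abs_of_nonneg (density_nonneg hq₀i m x)]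
    exact Finset.sum_le_sum fun i _ => sq_le_sq' (by
      linarith [(abs_le.1 (abs_primitive_le (eigenvector hq₀i i) x)).1])
      ((le_abs_self _).trans (abs_primitive_le _ _))
  -- The supergradient at the weak limit q₀ is a fixed bounded function, so weak convergence makes
  -- the linear term vanish; this is upper semicontinuity of E.
  have h1 := (hweak _ B hc.measurable hb).sub_const (∫ x, q₀ x * density hq₀i m x ∂unitMeasure)
  have h2 : Tendsto (fun k : ℕ => 1 / ((k : ℝ) + 1)) (hyperfilter ℕ) (𝓝 0) :=
    (tendsto_one_div_add_atTop_nhds_zero_nat (𝕜 := ℝ)).mono_left Nat.hyperfilter_le_atTop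
  have h3 := (h1.const_add (eigenvalueSum m q₀)).add h2
  rw [sub_self, add_zero, add_zero] at h3
  refine ge_of_tendsto h3 (Eventually.of_forall fun k => ?_)
  have h4 := eigenvalueSum_le_add (hqi k) hq₀i m
  have h5 : ∫ x, (q k x - q₀ x) * density hq₀i m x ∂unitMeasure =
      ∫ x, q k x * density hq₀i m x ∂unitMeasure - ∫ x, q₀ x * density hq₀i m x ∂unitMeasure := by
    rw [← integral_sub (integrable_mul_continuous (hqi k) hc) (integrable_mul_continuous hq₀i hc)]
    simp only [sub_mul]
  linarith [hq k]

/-! ### The critical system -/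

lemma IsDirichletSolution.congr_ae {q q' : ℝ → ℝ} (h : q =ᵐ[unitMeasure] q') {lam : ℝ}
    {ψ : ℝ → ℝ} (hψ : IsDirichletSolution q lam ψ) : IsDirichletSolution q' lam ψ := by
  obtain ⟨⟨w, hw, hac, heq⟩, h01⟩ := hψ
  refine ⟨⟨w, hw, hac, ?_⟩, h01⟩
  filter_upwards [heq, h] with x ⟨w', hw', hx⟩ hq
  exact ⟨w', hw', hq ▸ hx⟩

lemma isDirichletEigenvalue_congr_ae {q q' : ℝ → ℝ} (h : q =ᵐ[unitMeasure] q') :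
    IsDirichletEigenvalue q = IsDirichletEigenvalue q' := by
  ext lam
  exact ⟨fun ⟨ψ, hψ, h0⟩ => ⟨ψ, hψ.congr_ae h, h0⟩, fun ⟨ψ, hψ, h0⟩ => ⟨ψ, hψ.congr_ae h.symm, h0⟩⟩

lemma eigenvalueSum_congr_ae {q q' : ℝ → ℝ} (h : q =ᵐ[unitMeasure] q') (m : ℕ) :
    eigenvalueSum m q = eigenvalueSum m q' := by
  simp only [eigenvalueSum, dirichletEigenvalue, isDirichletEigenvalue_congr_ae h]

/-- A potential that is dual to its own density yields a solution of the critical system. -/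
lemma exists_isCriticalSolution {p r ε : ℝ} (hp : 1 < p) (hr : 0 < r) {m : ℕ} (hm : 0 < m)
    {q : ℝ → ℝ} (hqi : Integrable q unitMeasure)
    (hq : q =ᵐ[unitMeasure] fun x => ε * dualPotential p r (density hqi m) x) :
    ∃ u : Fin m → ℝ → ℝ, IsCriticalSolution p ε (fun i => dirichletEigenvalue q i) u ∧
      ∫ x in (0 : ℝ)..1, (∑ i, u i x ^ 2) ^ conjExponent p = r ^ p ∧
      q =ᵐ[unitMeasure] criticalPotential p ε u := by
  have hρ := continuous_density hqi m
  have hρ0 := density_nonneg hqi m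
  have hpos : 0 < ∫ x, density hqi m x ∂unitMeasure := by
    rw [integral_density]; exact_mod_cast hm
  set c := dualConst p r (density hqi m) with hc
  have hcpos : 0 < c := dualConst_pos hp hr hρ hρ0 hpos
  -- Since p* - 1 = 1/(p - 1), the choice k² = c^(p - 1) turns (k² ρ)^(p* - 1) into c ρ^(p* - 1),
  -- the dual potential.
  set k := c ^ ((p - 1) / 2) with hk
  have hkpos : 0 < k := Real.rpow_pos_of_pos hcpos _
  have hk2 : k ^ 2 = c ^ (p - 1) := by
    rw [hk, ← Real.rpow_natCast, ← Real.rpow_mul hcpos.le]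
    congr 1
    push_cast; ring
  set u : Fin m → ℝ → ℝ := fun i x => k * primitive (eigenvector hqi i) x with hu
  have hsum : ∀ x, ∑ i, u i x ^ 2 = k ^ 2 * density hqi m x := fun x => by
    simp only [hu, mul_pow, density, Finset.mul_sum]
  have hsum0 : ∀ x, 0 ≤ ∑ i, u i x ^ 2 := fun x => Finset.sum_nonneg fun _ _ => sq_nonneg _
  have hdual : ∀ x, (∑ i, u i x ^ 2) ^ (conjExponent p - 1)
      = dualPotential p r (density hqi m) x := fun x => by
    rw [hsum, Real.mul_rpow (sq_nonneg k) (hρ0 x), hk2, ← Real.rpow_mul hcpos.le,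
      conjExponent_sub_one hp, mul_inv_cancel₀ (by linarith), Real.rpow_one, dualPotential,
      conjExponent_sub_one hp]
  have hcrit : q =ᵐ[unitMeasure] criticalPotential p ε u := by
    filter_upwards [hq] with x hx
    rw [hx, criticalPotential, hdual]
  -- Using this continuous representative of q in the second derivative makes the equation hold at
  -- every point of [0, 1].
  have hcc : Continuous (criticalPotential p ε u) := by
    have : criticalPotential p ε u = fun x => ε * dualPotential p r (density hqi m) x := by
      ext x; rw [criticalPotential, hdual]
    rw [this]
    exact (continuous_dualPotential hp hρ).const_mul ε
  refine ⟨u, ⟨?_, fun i => ⟨?_, ?_⟩, fun i => ?_⟩, ?_, hcrit⟩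
  · have hsol := fun i : Fin m => (isWeakSolution_iff hqi).1 (eigenvector_isWeakSolution hqi i)
    choose d hd using fun i => (hsol i).2
    refine ⟨fun i x => k * (d i + primitive (secondDerivative q (dirichletEigenvalue q i)
      (eigenvector hqi i)) x), fun i x => k * secondDerivative (criticalPotential p ε u)
      (dirichletEigenvalue q i) (eigenvector hqi i) x, fun i x hx => ⟨?_, ?_, ?_⟩⟩
    · exact (hasDerivWithinAt_primitive (continuous_const.add (continuous_primitive
        (integrable_secondDerivative hqi _ _))).continuousOn (hd i) hx).const_mul k
    · refine ((hasDerivWithinAt_primitive ?_ ?_ hx).const_add (d i)).const_mul k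
      · exact ((hcc.sub continuous_const).mul
          (continuous_primitive (L2Unit.integrable _))).continuousOn
      · filter_upwards [hcrit] with t ht
        simp only [secondDerivative, ht]
    · simp only [hu, secondDerivative]; ring
  · simp [hu]
  · have := mem_dirichletSpace.1 (eigenvector_isWeakSolution hqi i).1
    simp [hu, this]
  · by_contra! h
    have h0 : massForm (eigenvector hqi i) (eigenvector hqi i) = 0 := by
      rw [massForm_self, integral_congr_ae (g := fun _ => 0)]
      · simp
      · filter_upwards [ae_restrict_mem measurableSet_Icc] with x hx
        have := (mul_eq_zero.1 (h x hx)).resolve_left hkpos.ne'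
        rw [this]; simp
    rw [massForm_eigenvector_self] at h0
    exact one_ne_zero h0
  · rw [← integral_unitMeasure_eq, ← integral_dualPotential_rpow hp hr hρ hρ0 hpos]
    congr 1
    ext x
    rw [← hdual, ← Real.rpow_mul (hsum0 x), conjExponent_sub_one_mul hp]

lemma coe_mem_potentialBall_iff {p r : ℝ} (hp : 1 < p) (hr : 0 < r) (q : LpSpace p) :
    (q : ℝ → ℝ) ∈ potentialBall p r ↔ q ∈ lpBall p r := by
  have hp0 : ENNReal.ofReal p ≠ 0 := by simpa using by linarith
  have htop : ENNReal.ofReal p ≠ ⊤ := ENNReal.ofReal_ne_top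
  have hreal : (ENNReal.ofReal p).toReal = p := ENNReal.toReal_ofReal (by linarith)
  have hi := (Lp.memLp q).integrable_norm_rpow hp0 htop
  rw [hreal] at hi
  have hnn : 0 ≤ ∫ x, |q x| ^ p ∂unitMeasure :=
    integral_nonneg fun x => Real.rpow_nonneg (abs_nonneg _) _
  have hnorm : ‖q‖ = (∫ x, |q x| ^ p ∂unitMeasure) ^ p⁻¹ := by
    rw [Lp.norm_def, (Lp.memLp q).eLpNorm_eq_integral_rpow_norm hp0 htop, hreal]
    simp only [Real.norm_eq_abs]
    exact ENNReal.toReal_ofReal (Real.rpow_nonneg hnn _)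
  have : q ∈ lpBall p r ↔ ∫ x, |q x| ^ p ∂unitMeasure ≤ r ^ p := by
    change ‖q‖ ≤ r ↔ _
    rw [hnorm, Real.rpow_inv_le_iff_of_pos hnn hr.le (by linarith)]
  rw [this]
  exact ⟨fun h => h.2.2, fun h => ⟨Lp.aestronglyMeasurable q, hi, h⟩⟩

lemma exists_coe_ae_eq {p r : ℝ} (hp : 1 < p) {f : ℝ → ℝ} (hf : f ∈ potentialBall p r) :
    ∃ q : LpSpace p, (q : ℝ → ℝ) =ᵐ[unitMeasure] f := by
  have hp0 : ENNReal.ofReal p ≠ 0 := by simpa using by linarith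
  have hreal : (ENNReal.ofReal p).toReal = p := ENNReal.toReal_ofReal (by linarith)
  have hm : MemLp f (ENNReal.ofReal p) unitMeasure := by
    rw [← integrable_norm_rpow_iff hf.1 hp0 ENNReal.ofReal_ne_top, hreal]
    exact hf.2.1
  exact ⟨hm.toLp f, hm.coeFn_toLp⟩

lemma potentialBall_congr_ae {p r : ℝ} {f g : ℝ → ℝ} (h : f =ᵐ[unitMeasure] g)
    (hf : f ∈ potentialBall p r) : g ∈ potentialBall p r := by
  have h2 : (fun x => |f x| ^ p) =ᵐ[unitMeasure] fun x => |g x| ^ p := by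
    filter_upwards [h] with x hx using by rw [hx]
  exact ⟨hf.1.congr h, hf.2.1.congr h2, (integral_congr_ae h2).symm.trans_le hf.2.2⟩

end

/-! ### Transfer to L^p classes -/

theorem theorem1p1 (p r : ℝ) (hp : 1 < p) (hr : 0 < r) (m : ℕ) (hm : 2 ≤ m) :
    -- the eigenvalues of every potential form an increasing sequence tending to infinity
    (∀ q : LpSpace p,
      StrictMono (dirichletEigenvalue q) ∧
      range (dirichletEigenvalue q) = {lam | IsDirichletEigenvalue q lam} ∧
      Tendsto (dirichletEigenvalue q) atTop atTop) ∧
    -- the minimum and the maximum are attained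
    (∃ q ∈ lpBall p r, IsMinOn (eigenvalueSumLp p m) (lpBall p r) q) ∧
    (∃ q ∈ lpBall p r, IsMaxOn (eigenvalueSumLp p m) (lpBall p r) q) ∧
    -- every minimizer
    (∀ q ∈ lpBall p r, IsMinOn (eigenvalueSumLp p m) (lpBall p r) q →
      ∃ (μ : Fin m → ℝ) (u : Fin m → ℝ → ℝ),
        IsCriticalSolution p (-1) μ u ∧
        ∫ x in (0 : ℝ)..1, (∑ i, u i x ^ 2) ^ conjExponent p = r ^ p ∧
        q =ᵐ[unitMeasure] criticalPotential p (-1) u ∧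
        IsLeast (eigenvalueSumLp p m '' lpBall p r) (∑ i, μ i)) ∧
    -- every maximizer
    (∀ q ∈ lpBall p r, IsMaxOn (eigenvalueSumLp p m) (lpBall p r) q →
      ∃ (μ : Fin m → ℝ) (u : Fin m → ℝ → ℝ),
        IsCriticalSolution p 1 μ u ∧
        ∫ x in (0 : ℝ)..1, (∑ i, u i x ^ 2) ^ conjExponent p = r ^ p ∧
        q =ᵐ[unitMeasure] criticalPotential p 1 u ∧
        IsGreatest (eigenvalueSumLp p m '' lpBall p r) (∑ i, μ i)) := by
  have hm0 : 0 < m := by omega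
  have hint : ∀ q : LpSpace p, Integrable q unitMeasure := fun q =>
    (Lp.memLp q).integrable (by simpa using hp.le)
  have hball := coe_mem_potentialBall_iff hp hr
  -- The eigenvalues depend only on the almost everywhere class, so extremality among functions and
  -- among elements of L^p is the same.
  have hlift : ∀ f ∈ potentialBall p r, ∃ q ∈ lpBall p r,
      (q : ℝ → ℝ) =ᵐ[unitMeasure] f ∧ eigenvalueSumLp p m q = eigenvalueSum m f := fun f hf => by
    obtain ⟨q, hq⟩ := exists_coe_ae_eq hp hf
    exact ⟨q, (hball q).1 (potentialBall_congr_ae hq.symm hf), hq, eigenvalueSum_congr_ae hq m⟩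
  refine ⟨fun q => dirichletEigenvalue_enumeration (hint q), ?_, ?_, fun q hq hmin => ?_,
    fun q hq hmax => ?_⟩
  · obtain ⟨f, hf, hmin⟩ := exists_minimizer hp hr hm0
    obtain ⟨q, hq, -, he⟩ := hlift f hf
    refine ⟨q, hq, fun q' hq' => ?_⟩
    change eigenvalueSumLp p m q ≤ eigenvalueSumLp p m q'
    rw [he]
    exact hmin _ ((hball q').2 hq')
  · obtain ⟨f, hf, hmax⟩ := exists_maximizer hp hr m
    obtain ⟨q, hq, -, he⟩ := hlift f hf
    refine ⟨q, hq, fun q' hq' => ?_⟩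
    change eigenvalueSumLp p m q' ≤ eigenvalueSumLp p m q
    rw [he]
    exact hmax _ ((hball q').2 hq')
  · have h1 := minimizer_eq_dualPotential hp hr hm0 ((hball q).2 hq) (hint q) fun f hf => by
      obtain ⟨q', hq', -, he⟩ := hlift f hf
      rw [← he]
      exact hmin hq'
    obtain ⟨u, hu, hI, hcrit⟩ := exists_isCriticalSolution (ε := -1) hp hr hm0 (hint q)
      (by simpa only [neg_one_mul] using h1)
    refine ⟨_, u, hu, hI, hcrit, ?_⟩
    have he : ∑ i : Fin m, dirichletEigenvalue q i = eigenvalueSumLp p m q := by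
      rw [eigenvalueSumLp, eigenvalueSum, Finset.sum_range]
    rw [he]
    refine ⟨⟨q, hq, rfl⟩, ?_⟩
    rintro _ ⟨q', hq', rfl⟩
    exact hmin hq'
  · have h1 := maximizer_eq_dualPotential hp hr hm0 ((hball q).2 hq) (hint q) fun f hf => by
      obtain ⟨q', hq', -, he⟩ := hlift f hf
      rw [← he]
      exact hmax hq'
    obtain ⟨u, hu, hI, hcrit⟩ := exists_isCriticalSolution (ε := 1) hp hr hm0 (hint q)
      (by simpa only [one_mul] using h1)
    refine ⟨_, u, hu, hI, hcrit, ?_⟩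
    have he : ∑ i : Fin m, dirichletEigenvalue q i = eigenvalueSumLp p m q := by
      rw [eigenvalueSumLp, eigenvalueSum, Finset.sum_range]
    rw [he]
    refine ⟨⟨q, hq, rfl⟩, ?_⟩
    rintro _ ⟨q', hq', rfl⟩
    exact hmax hq'
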